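/- Let $X$ be a set with at least two points and let $H_k$ be a reproducing kernel Hilbert space (RKHS) of complex-valued functions on $X$, with kernel $k$, normalized at $x_0\in X$, i.e. $k(x,x_0)=1$ for all $x\in X$. A multiplier of $H_k$ is a function $\phi:X\to\mathbb{C}$ with $\phi f\in H_k$ for all $f\in H_k$; $\mathrm{Mult}(H_k)$ is the algebra of multipliers, $M_\phi f=\phi f$ the (automatically bounded) multiplication operator, $\|\phi\|_{\mathrm{Mult}(H_k)}=\|M_\phi\|$, and $\|\phi\|_\infty=\sup_{x\in X}|\phi(x)|$. Call $H_k$ *of weak Hardy type* if it is normalized at some point of $X$ and 1. (irreducible) $k(x,y)\neq 0$ for all $x,y\in X$, and $k(\cdot,x)$, $k(\cdot,y)$ are linearly independent whenever $x\ne y$; 2. (complete Nevanlinna–Pick) whenever $m,n\in\mathbb{N}$, $x_1,\dots,x_n\in X$ and $W_1,\dots,W_n$ are complex $m\times m$ matrices such that the block matrix $[(I-W_iW_j^*)k(x_i,x_j)]_{i,j=1}^n$ is positive semidefinite, there is $\Phi\in\mathbb{M}_m(\mathbb{C})\otimes\mathrm{Mult}(H_k)$ with $\Phi(x_i)=W_i$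 for $1\le i\le n$ and $\|\Phi\|\le 1$, the norm being that of the operator $[M_{\Phi_{ij}}]_{i,j}$ on the direct sum of $m$ copies of $H_k$; 3. $\|\phi\|_{\mathrm{Mult}(H_k)}=\|\phi\|_\infty$ for all $\phi\in\mathrm{Mult}(H_k)$. A set $A$ contained in the open unit disk $\mathbb{D}$ is *dominating* if $\sup_{z\in A}|\Phi(z)|=\sup_{z\in\mathbb{D}}|\Phi(z)|$ for every bounded holomorphic function $\Phi$ on $\mathbb{D}$. Let $H^2$ be the Hardy space on $\mathbb{D}$, that is, the RKHS of all power series $f(z)=\sum_{n\ge0}a_nz^n$ with $\|f\|^2=\sum_n|a_n|^2<\infty$. **Theorem.** $H_k$ is of weak Hardy type if and only if there exist a dominating set $A\subset\mathbb{D}$ and a bijection $j:X\to A$ such that $j\in\mathrm{Mult}(H_k)$, $j(x_0)=0$ and $$k(x,y)=\frac{1}{1-j(x)\overline{j(y)}}\qquad(x,y\in X).$$ Moreover, for every such $A$ and $j$, the map $U:H^2\to H_k$, $f\mapsto f\circ j$, is a unitary operator. -/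

import Mathlib

open scoped ComplexConjugate ComplexOrder ENNReal Complex.UnitDisc

set_option linter.unusedSectionVars false

noncomputable section

namespace WeakHardy

section RKHSNotions

/- `H` is a reproducing kernel Hilbert space of complex-valued functions on `X`
(Mathlib's class `RKHS`); an element `f : H` is a function `X → ℂ` through its coercion. -/
variable (H : Type*) {X : Type*} [NormedAddCommGroup H] [InnerProductSpace ℂ H]
  [CompleteSpace H] [RKHS ℂ H X ℂ]

/-- The kernel function `k_y = k(·, y)`, an element of `H`. -/
def kerVec (y : X) : H := RKHS.kerFun H y 1

/-- The (scalar) reproducing kernel `k(x, y) = k_y(x)` of `H`. -/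
def ker (x y : X) : ℂ := kerVec H y x

theorem inner_kerVec (f : H) (y : X) : inner ℂ (kerVec H y) f = f y := by
  simp [kerVec]

/-- `H` is normalized at `x₀`: `k(x, x₀) = 1` for all `x`. -/
def IsNormalizedAt (x₀ : X) : Prop := ∀ x : X, ker H x x₀ = 1

/-- `H` is irreducible: its kernel has no zeros, and kernel functions at two distinct points are
linearly independent. -/
def IsIrreducible : Prop :=
  (∀ x y : X, ker H x y ≠ 0) ∧
    ∀ x y : X, x ≠ y → LinearIndependent ℂ ![kerVec H x, kerVec H y]

/-- `φ : X → ℂ` is a multiplier of `H` if `φ f ∈ H` for all `f ∈ H`. -/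
def IsMultiplier (φ : X → ℂ) : Prop := ∀ f : H, ∃ g : H, ∀ x, g x = φ x * f x

/-- The multiplier algebra `Mult(H)`, an algebra of functions on `X`. -/
def Mult : Subalgebra ℂ (X → ℂ) where
  carrier := {φ | IsMultiplier H φ}
  mul_mem' := by
    intro φ ψ hφ hψ f
    obtain ⟨g, hg⟩ := hψ f
    obtain ⟨h, hh⟩ := hφ g
    exact ⟨h, fun x => by rw [hh, hg, Pi.mul_apply, mul_assoc]⟩
  add_mem' := by
    intro φ ψ hφ hψ f
    obtain ⟨g, hg⟩ := hφ f
    obtain ⟨h, hh⟩ := hψ f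
    exact ⟨g + h, fun x => by simp [hg, hh, add_mul]⟩
  algebraMap_mem' := by
    intro c f
    exact ⟨c • f, fun x => by simp [Pi.algebraMap_apply]⟩

variable {H}

/-- The multiplication operator `M_φ f = φ f`, as a linear map. -/
def mulLin (φ : Mult H) : H →ₗ[ℂ] H where
  toFun f := (φ.2 f).choose
  map_add' f g := by
    ext x
    rw [(φ.2 (f + g)).choose_spec x, RKHS.coe_add, RKHS.coe_add, Pi.add_apply, Pi.add_apply,
      (φ.2 f).choose_spec x, (φ.2 g).choose_spec x, mul_add]
  map_smul' c f := by
    ext x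
    rw [(φ.2 (c • f)).choose_spec x, RKHS.coe_smul, RingHom.id_apply, RKHS.coe_smul,
      Pi.smul_apply, Pi.smul_apply, (φ.2 f).choose_spec x, smul_eq_mul, smul_eq_mul]
    ring

theorem mulLin_apply (φ : Mult H) (f : H) (x : X) :
    mulLin φ f x = (φ : X → ℂ) x * f x := (φ.2 f).choose_spec x

/-- The multiplication operator `M_φ f = φ f` as a bounded operator on `H`; boundedness is the
closed graph theorem. The multiplier norm of `φ` is the operator norm `‖mulOp φ‖`. -/
def mulOp (φ : Mult H) : H →L[ℂ] H :=
  ContinuousLinearMap.ofSeqClosedGraph (g := mulLin φ) (by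
    intro u f g hu hg
    ext x
    have h1 : Filter.Tendsto (fun n => (u n) x) Filter.atTop (nhds (f x)) :=
      ((RKHS.continuous_eval (𝕜 := ℂ) (V := ℂ) (H := H) x).tendsto f).comp hu
    have h2 : Filter.Tendsto (fun n => (mulLin φ (u n)) x) Filter.atTop (nhds (g x)) :=
      ((RKHS.continuous_eval (𝕜 := ℂ) (V := ℂ) (H := H) x).tendsto g).comp hg
    simp only [mulLin_apply] at h2 ⊢
    exact tendsto_nhds_unique h2 (h1.const_mul _))

theorem mulOp_apply (φ : Mult H) (f : H) (x : X) :
    mulOp φ f x = (φ : X → ℂ) x * f x := mulLin_apply φ f x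

/-- For `Φ = [φ_ij]` in `M_m(ℂ) ⊗ Mult(H) = M_m(Mult(H))`, the operator
`(f_j)_j ↦ (∑_j φ_ij f_j)_i` on the Hilbert space direct sum of `m` copies of `H`. The norm of `Φ`
in `M_m(ℂ) ⊗ Mult(H)` is the operator norm `‖matMulOp Φ‖`. -/
def matMulOp {m : ℕ} (Φ : Matrix (Fin m) (Fin m) (Mult H)) :
    PiLp 2 (fun _ : Fin m => H) →L[ℂ] PiLp 2 (fun _ : Fin m => H) :=
  ((PiLp.continuousLinearEquiv 2 ℂ (fun _ : Fin m => H)).symm :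
      (Fin m → H) →L[ℂ] PiLp 2 (fun _ : Fin m => H)) ∘L
    (ContinuousLinearMap.pi fun i =>
      ∑ j, mulOp (Φ i j) ∘L (ContinuousLinearMap.proj j : (Fin m → H) →L[ℂ] H)) ∘L
    ((PiLp.continuousLinearEquiv 2 ℂ (fun _ : Fin m => H)) :
      PiLp 2 (fun _ : Fin m => H) →L[ℂ] (Fin m → H))

theorem matMulOp_apply {m : ℕ} (Φ : Matrix (Fin m) (Fin m) (Mult H))
    (f : PiLp 2 (fun _ : Fin m => H)) (i : Fin m) :
    matMulOp Φ f i = ∑ j, mulOp (Φ i j) (f j) := by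
  simp [matMulOp]

variable (H)

/-- `H` is a complete Nevanlinna–Pick space: whenever the block matrix
`[(I - W_i W_j^*) k(x_i, x_j)]_{i,j}` is positive semidefinite, there is
`Φ ∈ M_m(ℂ) ⊗ Mult(H)` of norm at most one with `Φ(x_i) = W_i` for all `i`. -/
def IsCompleteNevanlinnaPick : Prop :=
  ∀ (m n : ℕ) (x : Fin n → X) (W : Fin n → Matrix (Fin m) (Fin m) ℂ),
    (Matrix.of fun p q : Fin n × Fin m =>
        (1 - W p.1 * (W q.1).conjTranspose) p.2 q.2 * ker H (x p.1) (x q.1)).PosSemidef →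
      ∃ Φ : Matrix (Fin m) (Fin m) (Mult H),
        (∀ i : Fin n, (Φ.map fun φ => (φ : X → ℂ) (x i)) = W i) ∧ ‖matMulOp Φ‖ ≤ 1

/-- `H` is of weak Hardy type: it is a normalized irreducible complete Nevanlinna–Pick space such
that the multiplier norm of every multiplier is its supremum norm over `X` (the supremum is taken
in `[0, ∞]`). -/
def IsWeakHardyType : Prop :=
  (∃ x₀ : X, IsNormalizedAt H x₀) ∧ IsIrreducible H ∧ IsCompleteNevanlinnaPick H ∧
    ∀ φ : Mult H, ‖mulOp φ‖ₑ = ⨆ x : X, ‖(φ : X → ℂ) x‖ₑ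

end RKHSNotions

/-- A set `A ⊆ 𝔻` is dominating if `sup_A |Φ| = sup_𝔻 |Φ|` for all bounded holomorphic functions
`Φ` on the unit disk (the suprema are taken in `[0, ∞]`). -/
def IsDominating (A : Set 𝔻) : Prop :=
  ∀ Φ : ℂ → ℂ, DifferentiableOn ℂ Φ (Metric.ball 0 1) →
    (∃ C : ℝ, ∀ z ∈ Metric.ball (0 : ℂ) 1, ‖Φ z‖ ≤ C) →
      ⨆ z ∈ A, ‖Φ (z : ℂ)‖ₑ = ⨆ z : 𝔻, ‖Φ (z : ℂ)‖ₑ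

section HardySpace

/-- The Hardy space `H²` on the unit disk, the space of power series `∑ a_n z^n` with
`‖f‖² = ∑ |a_n|² < ∞`: as a Hilbert space it is the space `ℓ²` of Taylor coefficients. -/
def HardySpace : Type := lp (fun _ : ℕ => ℂ) 2

instance : NormedAddCommGroup HardySpace :=
  inferInstanceAs (NormedAddCommGroup (lp (fun _ : ℕ => ℂ) 2))

instance : InnerProductSpace ℂ HardySpace :=
  inferInstanceAs (InnerProductSpace ℂ (lp (fun _ : ℕ => ℂ) 2))

instance : CompleteSpace HardySpace :=
  inferInstanceAs (CompleteSpace (lp (fun _ : ℕ => ℂ) 2))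

/-- The sequence of Taylor coefficients at `0` of an element of the Hardy space. -/
def HardySpace.taylorCoeff (f : HardySpace) (n : ℕ) : ℂ := (show lp (fun _ : ℕ => ℂ) 2 from f) n

/-- The Szegő kernel function at `z`, with Taylor coefficients `conj z ^ n`. -/
def szego (z : 𝔻) : HardySpace :=
  (⟨fun n => conj (z : ℂ) ^ n, by
    refine memℓp_gen ?_
    have h : Summable fun n : ℕ => (‖(z : ℂ)‖ ^ 2) ^ n :=
      summable_geometric_of_lt_one (by positivity) z.sq_norm_lt_one
    refine h.congr fun n => ?_
    simp [← pow_mul, mul_comm]⟩ : lp (fun _ : ℕ => ℂ) 2)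

theorem hasSum_inner_szego (f : HardySpace) (z : 𝔻) :
    HasSum (fun n => f.taylorCoeff n * (z : ℂ) ^ n) (inner ℂ (szego z) f) := by
  have h := lp.hasSum_inner (𝕜 := ℂ) (szego z : lp (fun _ : ℕ => ℂ) 2)
    (f : lp (fun _ : ℕ => ℂ) 2)
  have e : (fun n => f.taylorCoeff n * (z : ℂ) ^ n) = fun n =>
      inner ℂ ((szego z).taylorCoeff n) (f.taylorCoeff n) := by
    funext n
    change _ = (f.taylorCoeff n) * conj (conj (z : ℂ) ^ n)
    simp
  rw [e]
  exact h

/-- The Hardy space is a reproducing kernel Hilbert space on `𝔻`, an element with Taylor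
coefficients `a_n` being the function `z ↦ ∑ a_n z ^ n`. -/
instance : RKHS ℂ HardySpace 𝔻 ℂ where
  coeCLM := ContinuousLinearMap.pi fun z => innerSL ℂ (szego z)
  coeCLM_injective := by
    refine (injective_iff_map_eq_zero _).mpr fun f hf => ?_
    let p : FormalMultilinearSeries ℂ ℂ ℂ := .ofScalars ℂ f.taylorCoeff
    have hp : HasFPowerSeriesOnBall (0 : ℂ → ℂ) p 0 1 := by
      refine ⟨?_, one_pos, fun {y} hy => ?_⟩
      · refine p.le_radius_of_bound (r := 1) ‖f‖ fun n => ?_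
        have h1 : ‖f.taylorCoeff n‖ ≤ ‖f‖ :=
          lp.norm_apply_le_norm (by norm_num) (show lp (fun _ : ℕ => ℂ) 2 from f) n
        have h2 : ‖p n‖ = ‖f.taylorCoeff n‖ :=
          FormalMultilinearSeries.ofScalars_norm (E := ℂ) f.taylorCoeff n
        rw [h2]
        simpa using h1
      · have hy1 : ‖y‖ < 1 := by
          have h1 : ‖y‖ₑ < 1 := by simpa using hy
          rw [← ofReal_norm, ENNReal.ofReal_lt_one] at h1
          exact h1
        have h1 := hasSum_inner_szego f (.mk y hy1)
        have h2 : inner ℂ (szego (.mk y hy1)) f = 0 := congrFun hf (.mk y hy1)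
        rw [h2] at h1
        have e : (fun n => f.taylorCoeff n * y ^ n) = fun n => p n fun _ => y := by
          funext n
          simp [p, mul_comm]
        rw [← e]
        exact h1
    have h0 : p = 0 := hp.hasFPowerSeriesAt.eq_zero
    have h1 : f.taylorCoeff = 0 :=
      (FormalMultilinearSeries.ofScalars_series_eq_zero (𝕜 := ℂ) (E := ℂ)).mp h0
    exact lp.ext h1

/-- Elements of the Hardy space are the sums of their Taylor series. -/
theorem HardySpace.hasSum_apply (f : HardySpace) (z : 𝔻) :
    HasSum (fun n => f.taylorCoeff n * (z : ℂ) ^ n) (f z) := hasSum_inner_szego f z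

/-- The reproducing kernel of the Hardy space is `1 / (1 - z * conj w)`. -/
theorem ker_hardySpace (z w : 𝔻) : ker HardySpace z w = 1 / (1 - (z : ℂ) * conj (w : ℂ)) := by
  have hv : kerVec HardySpace w = szego w := by
    refine ext_inner_right ℂ fun f => ?_
    rw [inner_kerVec]
    exact (hasSum_inner_szego f w).unique (HardySpace.hasSum_apply f w) ▸ rfl
  have h1 := HardySpace.hasSum_apply (szego w) z
  have hlt : ‖(z : ℂ) * conj (w : ℂ)‖ < 1 := by
    rw [norm_mul, RCLike.norm_conj]
    exact mul_lt_one_of_nonneg_of_lt_one_left (norm_nonneg _) z.norm_lt_one w.norm_lt_one.le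
  have h2 := hasSum_geometric_of_norm_lt_one hlt
  rw [ker, hv, one_div]
  refine h1.unique ?_
  have e : (fun n => (szego w).taylorCoeff n * (z : ℂ) ^ n) =
      fun n => ((z : ℂ) * conj (w : ℂ)) ^ n := by
    funext n
    rw [mul_pow, mul_comm]
    rfl
  rw [e]
  exact h2

end HardySpace

end WeakHardy

end

/-!
Suppose first that `H` is of weak Hardy type. For a point `x₁ ≠ x₀`, the scalar Pick property
provides an extremal multiplier `f` for the problem `x₀ ↦ 0`, `x₁ ↦ max`. A contraction that
attains its norm at a vector preserves inner products with that vector; applied to the adjoint of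
`M_f` at `k_{x₁} - 1`, this shows that `f` is unique and that `r f k_{x₁} = k_{x₁} - 1` with `r =
f(x₁)`, and hence that `M_f` preserves the norm of `k_{x₁}`. For a further point `x₂`, the Pick
property for `2 × 2` matrices extends `f` to a contractive row `(f, g)` of multipliers in which
`|g(x₂)|² = 1 - 1 / k(x₂, x₂) - |f(x₂)|²`. Now `|f|² + |g|² ≤ 1` pointwise implies `|f ± g² / 2| ≤
1`. Since the multiplier norm is the supremum norm, both `f ± g² / 2` are contractive multipliers,
and the parallelogram law gives `‖f h‖² + ‖g² h / 2‖² ≤ ‖h‖²` for all `h`. The choice `h = k_{x₁}`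
forces `g = 0` (`eq_zero_of_norm_sq_add_norm_sq_le_one`). Therefore `k(x, x) = 1 / (1 - |f(x)|²)`
for all `x`, and the equality case of the Schwarz lemma for multipliers polarizes this identity
(`exists_ker_eq_szego`). Set `j = f`.

When the kernel is `1 / (1 - j(x) conj j(y))`, composition with `j` is a coisometry from `H²` onto
`H`, and it is unitary if and only if no nonzero element of `H²` vanishes on the range of `j`. If
some element does, dividing it by a power of `z` puts the indicator function of `x₀` into `H`.
This function is an idempotent multiplier, and if its norm is its supremum `1` then it equals
`k_{x₀} = 1`, which is absurd (`not_exists_eq_indicator`). So composition with `j` is unitary,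
bounded holomorphic functions become multipliers, and the equality of norms says that the range of
`j` is dominating.

Conversely, let the range of `j` be dominating. A set of zeros of a nonzero element of `H²` is
also a set of zeros of an inner function, as in Beurling's theorem
(`HardySpace.exists_bounded_eq_zero`). Hence composition with `j` is again unitary. The
multipliers of `H` are then the compositions with `j` of the bounded holomorphic functions, with
the supremum norm over the disk (`HardySpace.exists_eq_mul`, which rests on Parseval's identity),
and the latter is the supremum over the range of `j`. The complete Pick property only uses the
form of the kernel: it is the lurking isometry argument (`isCompleteNevanlinnaPick_of_ker_eq`).
-/

noncomputable section

namespace WeakHardy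

/-! ### Operators and elements defined by kernel functions -/

/-- A map defined on a family with dense span extends to a bounded operator as soon as it is
bounded on linear combinations. -/
theorem exists_clm_of_norm_le {ι H K : Type*} [NormedAddCommGroup H] [InnerProductSpace ℂ H]
    [NormedAddCommGroup K] [InnerProductSpace ℂ K] [CompleteSpace K] {v : ι → H} {w : ι → K}
    (hv : (Submodule.span ℂ (Set.range v)).topologicalClosure = ⊤) {M : ℝ} (hM : 0 ≤ M)
    (h : ∀ c : ι →₀ ℂ, ‖Finsupp.linearCombination ℂ w c‖ ≤
      M * ‖Finsupp.linearCombination ℂ v c‖) :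
    ∃ T : H →L[ℂ] K, (∀ i, T (v i) = w i) ∧ ‖T‖ ≤ M := by
  have hd : DenseRange (Finsupp.linearCombination ℂ v) := by
    have h1 := Finsupp.range_linearCombination (R := ℂ) (v := v)
    rw [← h1, ← Submodule.dense_iff_topologicalClosure_eq_top] at hv
    rwa [LinearMap.coe_range] at hv
  refine ⟨(Finsupp.linearCombination ℂ w).extendOfNorm (Finsupp.linearCombination ℂ v),
    fun i => ?_, LinearMap.opNorm_extendOfNorm_le hd hM h⟩
  have := LinearMap.extendOfNorm_eq hd ⟨M, h⟩ (Finsupp.single i 1)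
  simpa using this

/-- A contraction that preserves the norm of a vector `a` preserves all inner products
with `a`. -/
theorem inner_map_map_of_norm_map_eq {H K : Type*} [NormedAddCommGroup H] [InnerProductSpace ℂ H]
    [CompleteSpace H] [NormedAddCommGroup K] [InnerProductSpace ℂ K] [CompleteSpace K]
    {S : H →L[ℂ] K} (hS : ‖S‖ ≤ 1) {a : H} (ha : ‖S a‖ = ‖a‖) (b : H) :
    inner ℂ (S a) (S b) = inner ℂ a b := by
  have h1 : S.adjoint (S a) = a := by
    rw [← sub_eq_zero, ← norm_eq_zero, ← sq_eq_zero_iff]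
    have e : ‖S.adjoint (S a) - a‖ ^ 2 = ‖S.adjoint (S a)‖ ^ 2 - 2 * ‖S a‖ ^ 2 + ‖a‖ ^ 2 := by
      rw [norm_sub_sq (𝕜 := ℂ), ContinuousLinearMap.adjoint_inner_left,
        inner_self_eq_norm_sq (𝕜 := ℂ)]
    have h2 : ‖S.adjoint (S a)‖ ≤ ‖a‖ := by
      refine (S.adjoint.le_opNorm _).trans ?_
      rw [LinearIsometryEquiv.norm_map, ← ha]
      exact mul_le_of_le_one_left (norm_nonneg _) hS
    have h3 : ‖S.adjoint (S a)‖ ^ 2 ≤ ‖a‖ ^ 2 := by gcongr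
    rw [ha] at e
    nlinarith [sq_nonneg ‖S.adjoint (S a) - a‖]
  rw [← ContinuousLinearMap.adjoint_inner_left, h1]

section Kernel

variable {H : Type*} {X : Type*} [NormedAddCommGroup H] [InnerProductSpace ℂ H]
  [CompleteSpace H] [RKHS ℂ H X ℂ]

theorem inner_kerVec_right (f : H) (y : X) : inner ℂ f (kerVec H y) = conj (f y) := by
  rw [← inner_conj_symm, inner_kerVec]

theorem inner_kerVec_kerVec (x y : X) : inner ℂ (kerVec H x) (kerVec H y) = ker H x y := by
  rw [inner_kerVec, ker]

theorem conj_ker (x y : X) : conj (ker H x y) = ker H y x := by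
  rw [← inner_kerVec_kerVec, ← inner_kerVec_kerVec, inner_conj_symm]

theorem ker_self (x : X) : ker H x x = ((‖kerVec H x‖ ^ 2 : ℝ) : ℂ) := by
  rw [← inner_kerVec_kerVec, inner_self_eq_norm_sq_to_K]
  simp

theorem kerVec_apply (x y : X) : kerVec H y x = ker H x y := rfl

theorem topologicalClosure_span_kerVec :
    (Submodule.span ℂ (Set.range (kerVec H (X := X)))).topologicalClosure = ⊤ := by
  rw [Submodule.topologicalClosure_eq_top_iff, Submodule.eq_bot_iff]
  intro f hf
  refine RKHS.ext (𝕜 := ℂ) fun x => ?_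
  rw [← inner_kerVec, RKHS.coe_zero, Pi.zero_apply]
  exact (Submodule.mem_orthogonal _ _).1 hf _ (Submodule.subset_span ⟨x, rfl⟩)

theorem inner_linearCombination_kerVec (f : H) (c : X →₀ ℂ) :
    inner ℂ f (Finsupp.linearCombination ℂ (kerVec H) c) =
      Finsupp.linearCombination ℂ (fun x => conj (f x)) c := by
  simp [Finsupp.linearCombination_apply, Finsupp.sum, inner_kerVec_right]

/-- Bounded pointwise limits of elements of a reproducing kernel Hilbert space belong to it. -/
theorem exists_eq_of_tendsto_apply {f : ℕ → H} {g : X → ℂ} {C : ℕ → ℝ} {M : ℝ}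
    (hf : ∀ n, ‖f n‖ ≤ C n) (hC : Filter.Tendsto C Filter.atTop (nhds M))
    (hg : ∀ x, Filter.Tendsto (fun n => f n x) Filter.atTop (nhds (g x))) :
    ∃ h : H, (∀ x, h x = g x) ∧ ‖h‖ ≤ M := by
  have hM : 0 ≤ M := ge_of_tendsto' hC fun n => (norm_nonneg _).trans (hf n)
  obtain ⟨T, hT, hT'⟩ := exists_clm_of_norm_le (v := kerVec H (X := X)) (K := ℂ)
    (w := fun x => conj (g x)) topologicalClosure_span_kerVec hM (fun c => by
      have h1 : Filter.Tendsto (fun n => ‖inner ℂ (f n) (Finsupp.linearCombination ℂ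
          (kerVec H) c)‖) Filter.atTop
          (nhds ‖Finsupp.linearCombination ℂ (fun x => conj (g x)) c‖) := by
        refine Filter.Tendsto.norm ?_
        simp_rw [inner_linearCombination_kerVec, Finsupp.linearCombination_apply, Finsupp.sum]
        refine tendsto_finsetSum _ fun x _ => Filter.Tendsto.const_smul ?_ (c x)
        exact (Complex.continuous_conj.tendsto _).comp (hg x)
      refine le_of_tendsto_of_tendsto' h1 (hC.mul_const _) fun n => ?_
      exact (norm_inner_le_norm _ _).trans (by gcongr; exact hf n))
  refine ⟨(InnerProductSpace.toDual ℂ H).symm T, fun x => ?_, by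
    rwa [LinearIsometryEquiv.norm_map]⟩
  have h2 := InnerProductSpace.toDual_symm_apply (𝕜 := ℂ) (x := kerVec H x) (y := T)
  rw [inner_kerVec_right, hT] at h2
  exact (starRingEnd ℂ).injective h2

theorem adjoint_mulOp_kerVec (φ : Mult H) (x : X) :
    (mulOp φ).adjoint (kerVec H x) = conj ((φ : X → ℂ) x) • kerVec H x := by
  refine ext_inner_right ℂ fun f => ?_
  rw [ContinuousLinearMap.adjoint_inner_left, inner_kerVec, mulOp_apply, inner_smul_left,
    inner_kerVec, Complex.conj_conj]

theorem norm_apply_le_norm_mulOp (φ : Mult H) {x : X} (hx : ker H x x ≠ 0) :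
    ‖(φ : X → ℂ) x‖ ≤ ‖mulOp φ‖ := by
  have h0 : 0 < ‖kerVec H x‖ := by
    refine (norm_nonneg _).lt_of_ne fun h => hx ?_
    rw [ker_self, ← h]
    simp
  have h1 := (mulOp φ).adjoint.le_opNorm (kerVec H x)
  rw [adjoint_mulOp_kerVec, norm_smul, RCLike.norm_conj, LinearIsometryEquiv.norm_map] at h1
  exact le_of_mul_le_mul_right h1 h0

theorem mulOp_le_one_of_apply_le
    (hsup : ∀ φ : Mult H, ‖mulOp φ‖ₑ = ⨆ x : X, ‖(φ : X → ℂ) x‖ₑ) (φ : Mult H)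
    (h : ∀ x, ‖(φ : X → ℂ) x‖ ≤ 1) : ‖mulOp φ‖ ≤ 1 := by
  have h1 : ‖mulOp φ‖ₑ ≤ 1 := by
    rw [hsup]
    refine iSup_le fun x => ?_
    have := enorm_le_iff_norm_le.2 ((h x).trans_eq (norm_one (α := ℂ)).symm)
    simpa using this
  rw [← ofReal_norm, ENNReal.ofReal_le_one] at h1
  exact h1

end Kernel

section RankOne

variable {H : Type*} {X : Type*} [NormedAddCommGroup H] [InnerProductSpace ℂ H]
  [CompleteSpace H] [RKHS ℂ H X ℂ]

/-! ### Contractive multipliers vanishing at the base point -/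

theorem norm_mulOp_le_norm_matMulOp {m : ℕ} (Φ : Matrix (Fin m) (Fin m) (Mult H)) (i j : Fin m) :
    ‖mulOp (Φ i j)‖ ≤ ‖matMulOp Φ‖ := by
  refine ContinuousLinearMap.opNorm_le_bound _ (norm_nonneg _) fun f => ?_
  have h1 : mulOp (Φ i j) f = matMulOp Φ (PiLp.single 2 j f) i := by
    rw [matMulOp_apply, Finset.sum_eq_single j]
    · simp
    · intro l _ hl
      simp [hl]
    · simp
  rw [h1]
  refine (PiLp.norm_apply_le _ i).trans (((matMulOp Φ).le_opNorm _).trans_eq ?_)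
  rw [PiLp.norm_single]

/-- The rows of a contractive matrix of multipliers are pointwise in the Euclidean unit ball. -/
theorem sum_norm_sq_apply_le_one {m : ℕ} {Φ : Matrix (Fin m) (Fin m) (Mult H)}
    (hΦ : ‖matMulOp Φ‖ ≤ 1) (i : Fin m) {x : X} (hx : ker H x x ≠ 0) :
    ∑ j, ‖(Φ i j : X → ℂ) x‖ ^ 2 ≤ 1 := by
  set s : ℝ := ∑ j, ‖(Φ i j : X → ℂ) x‖ ^ 2 with hs
  set κ : ℝ := ‖kerVec H x‖ with hκ
  have h0 : 0 < κ := by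
    refine (norm_nonneg _).lt_of_ne fun h => hx ?_
    rw [ker_self, ← h]
    simp
  have hs0 : 0 ≤ s := by positivity
  let h : PiLp 2 (fun _ : Fin m => H) :=
    WithLp.toLp 2 fun j => conj ((Φ i j : X → ℂ) x) • kerVec H x
  have hh : ‖h‖ ^ 2 = s * κ ^ 2 := by
    rw [PiLp.norm_sq_eq_of_L2, hs, Finset.sum_mul]
    refine Finset.sum_congr rfl fun j _ => ?_
    simp [h, norm_smul, mul_pow, hκ]
  have h1 : inner ℂ (kerVec H x) (matMulOp Φ h i) = ((s * κ ^ 2 : ℝ) : ℂ) := by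
    rw [matMulOp_apply, inner_sum, hs, Finset.sum_mul, Complex.ofReal_sum]
    refine Finset.sum_congr rfl fun j _ => ?_
    rw [inner_kerVec, mulOp_apply]
    simp only [h, RKHS.coe_smul, Pi.smul_apply, smul_eq_mul, kerVec_apply, ker_self]
    rw [← mul_assoc, Complex.mul_conj, Complex.normSq_eq_norm_sq]
    push_cast
    rfl
  have h2 : s * κ ^ 2 ≤ κ * ‖h‖ := by
    have h3 := norm_inner_le_norm (𝕜 := ℂ) (kerVec H x) (matMulOp Φ h i)
    rw [h1, Complex.norm_real, Real.norm_of_nonneg (by positivity)] at h3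
    refine h3.trans (mul_le_mul_of_nonneg_left ?_ h0.le)
    refine (PiLp.norm_apply_le _ i).trans (((matMulOp Φ).le_opNorm _).trans ?_)
    exact mul_le_of_le_one_left (norm_nonneg _) hΦ
  have h3 : (s * κ ^ 2) ^ 2 ≤ (κ * ‖h‖) ^ 2 := by gcongr
  rw [mul_pow κ, hh] at h3
  have h4 : s * s * κ ^ 4 ≤ s * κ ^ 4 := by linarith
  have h5 := le_of_mul_le_mul_right h4 (by positivity)
  by_contra hlt
  nlinarith

theorem norm_kerVec_sub_sq {x₀ : X} (hx₀ : IsNormalizedAt H x₀) (x : X) :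
    ‖kerVec H x - kerVec H x₀‖ ^ 2 = ‖kerVec H x‖ ^ 2 - 1 := by
  have h0 : ‖kerVec H x₀‖ ^ 2 = 1 := by
    have := hx₀ x₀
    rw [ker_self] at this
    exact_mod_cast this
  rw [norm_sub_sq (𝕜 := ℂ), inner_kerVec_kerVec, hx₀ x, h0]
  simp
  ring

theorem adjoint_mulOp_kerVec_sub {x₀ : X} {φ : Mult H} (h0 : (φ : X → ℂ) x₀ = 0) (x : X) :
    (mulOp φ).adjoint (kerVec H x - kerVec H x₀) = conj ((φ : X → ℂ) x) • kerVec H x := by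
  rw [map_sub, adjoint_mulOp_kerVec, adjoint_mulOp_kerVec, h0]
  simp

/-- The Schwarz lemma for contractive multipliers vanishing at the base point. -/
theorem norm_sq_mul_le_of_apply_eq_zero {x₀ : X} (hx₀ : IsNormalizedAt H x₀) {φ : Mult H}
    (hφ : ‖mulOp φ‖ ≤ 1) (h0 : (φ : X → ℂ) x₀ = 0) (x : X) :
    ‖(φ : X → ℂ) x‖ ^ 2 * ‖kerVec H x‖ ^ 2 ≤ ‖kerVec H x‖ ^ 2 - 1 := by
  rw [← norm_kerVec_sub_sq hx₀, ← mul_pow]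
  have h1 := (mulOp φ).adjoint.le_opNorm (kerVec H x - kerVec H x₀)
  rw [adjoint_mulOp_kerVec_sub h0, norm_smul, RCLike.norm_conj, LinearIsometryEquiv.norm_map] at h1
  have h2 := h1.trans (mul_le_of_le_one_left (norm_nonneg _) hφ)
  gcongr

/-- Equality at one point in the Schwarz lemma determines the multiplier. -/
theorem apply_mul_conj_apply_mul_ker {x₀ : X} (hx₀ : IsNormalizedAt H x₀) {φ : Mult H}
    (hφ : ‖mulOp φ‖ ≤ 1) (h0 : (φ : X → ℂ) x₀ = 0) {a : X}
    (ha : ‖(φ : X → ℂ) a‖ ^ 2 * ‖kerVec H a‖ ^ 2 = ‖kerVec H a‖ ^ 2 - 1) (y : X) :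
    (φ : X → ℂ) a * conj ((φ : X → ℂ) y) * ker H a y = ker H a y - 1 := by
  have h1 := inner_map_map_of_norm_map_eq (S := (mulOp φ).adjoint)
    (by rwa [LinearIsometryEquiv.norm_map]) (a := kerVec H a - kerVec H x₀) (by
      rw [← sq_eq_sq₀ (norm_nonneg _) (norm_nonneg _), norm_kerVec_sub_sq hx₀,
        adjoint_mulOp_kerVec_sub h0, norm_smul, mul_pow, RCLike.norm_conj, ha])
    (kerVec H y - kerVec H x₀)
  rw [adjoint_mulOp_kerVec_sub h0, adjoint_mulOp_kerVec_sub h0, inner_smul_left, inner_smul_right,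
    inner_kerVec_kerVec, inner_sub_left, inner_sub_right, inner_sub_right] at h1
  simp only [inner_kerVec_kerVec, Complex.conj_conj] at h1
  rw [← conj_ker y x₀, hx₀, hx₀, hx₀] at h1
  simp only [map_one, sub_self, sub_zero] at h1
  rw [mul_assoc, h1]

/-- Suppose that the multiplier norm is the supremum norm, that `|f|² + |g|² ≤ 1`, and that `f`
preserves the norm of a nowhere vanishing function `h`. Then `g = 0`: the multipliers
`f ± g² / 2` are contractive since `|g|² / 2 ≤ (1 - |f|²) / 2 ≤ 1 - |f|`, and the parallelogram law
gives `‖f h‖² + ‖g² h / 2‖² ≤ ‖h‖²`. -/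
theorem eq_zero_of_norm_sq_add_norm_sq_le_one
    (hsup : ∀ φ : Mult H, ‖mulOp φ‖ₑ = ⨆ x : X, ‖(φ : X → ℂ) x‖ₑ) {f g : Mult H}
    (hfg : ∀ x, ‖(f : X → ℂ) x‖ ^ 2 + ‖(g : X → ℂ) x‖ ^ 2 ≤ 1) {h : H} (hh : ∀ x, h x ≠ 0)
    (hf : ‖mulOp f h‖ = ‖h‖) (x : X) : (g : X → ℂ) x = 0 := by
  set ψ : Mult H := (2⁻¹ : ℂ) • (g * g) with hψ
  have hψx : ∀ x, (ψ : X → ℂ) x = 2⁻¹ * ((g : X → ℂ) x * (g : X → ℂ) x) := fun x => by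
    simp [hψ]
  have hb : ∀ x, ‖(f : X → ℂ) x‖ + ‖(ψ : X → ℂ) x‖ ≤ 1 := fun x => by
    rw [hψx, norm_mul, norm_mul]
    have e : ‖(2⁻¹ : ℂ)‖ = 2⁻¹ := by simp
    rw [e]
    nlinarith [hfg x, sq_nonneg (‖(f : X → ℂ) x‖ - 1)]
  have h1 : ‖mulOp (f + ψ)‖ ≤ 1 := mulOp_le_one_of_apply_le hsup _ fun x =>
    (norm_add_le _ _).trans (hb x)
  have h2 : ‖mulOp (f - ψ)‖ ≤ 1 := mulOp_le_one_of_apply_le hsup _ fun x =>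
    (norm_sub_le _ _).trans (hb x)
  have e1 : mulOp (f + ψ) h = mulOp f h + mulOp ψ h := RKHS.ext (𝕜 := ℂ) fun x => by
    simp [mulOp_apply, RKHS.coe_add, add_mul]
  have e2 : mulOp (f - ψ) h = mulOp f h - mulOp ψ h := RKHS.ext (𝕜 := ℂ) fun x => by
    simp [mulOp_apply, RKHS.coe_sub, sub_mul]
  have h3 := ((mulOp (f + ψ)).le_opNorm h).trans (mul_le_of_le_one_left (norm_nonneg _) h1)
  have h4 := ((mulOp (f - ψ)).le_opNorm h).trans (mul_le_of_le_one_left (norm_nonneg _) h2)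
  rw [e1] at h3
  rw [e2] at h4
  have h5 := parallelogram_law_with_norm ℂ (mulOp f h) (mulOp ψ h)
  have h6 : ‖mulOp ψ h‖ = 0 := by
    rw [hf] at h5
    nlinarith [mul_self_le_mul_self (norm_nonneg _) h3, mul_self_le_mul_self (norm_nonneg _) h4,
      mul_self_nonneg ‖mulOp ψ h‖]
  have h7 := mulOp_apply ψ h x
  rw [norm_eq_zero.1 h6, hψx] at h7
  simpa [hh x] using h7.symm

/-! ### The complete Pick property forces rank one -/

theorem posSemidef_of_eq_inner {ι E : Type*} [Finite ι] [NormedAddCommGroup E]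
    [InnerProductSpace ℂ E]
    {M : Matrix ι ι ℂ} (v : ι → E) (h : ∀ p q, M p q = inner ℂ (v p) (v q)) : M.PosSemidef := by
  have : M = Matrix.gram ℂ v := by
    ext p q
    exact h p q
  rw [this]
  exact Matrix.posSemidef_gram ℂ v

theorem one_lt_norm_kerVec_sq {x₀ x : X} (hx₀ : IsNormalizedAt H x₀) (hirr : IsIrreducible H)
    (hx : x ≠ x₀) : 1 < ‖kerVec H x‖ ^ 2 := by
  have h1 : kerVec H x - kerVec H x₀ ≠ 0 := by
    rw [sub_ne_zero]
    exact (hirr.2 x x₀ hx).injective.ne (a₁ := 0) (a₂ := 1) (by simp)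
  have h2 : 0 < ‖kerVec H x - kerVec H x₀‖ ^ 2 := by positivity
  rw [norm_kerVec_sub_sq hx₀] at h2
  linarith

/-- The extremal multiplier for the two-point problem `x₀ ↦ 0`, `x₁ ↦ max`. -/
theorem exists_extremal_multiplier {x₀ x₁ : X} (hx₀ : IsNormalizedAt H x₀)
    (hnp : IsCompleteNevanlinnaPick H) {r : ℝ}
    (hr : r ^ 2 * ‖kerVec H x₁‖ ^ 2 = ‖kerVec H x₁‖ ^ 2 - 1) :
    ∃ f : Mult H, ‖mulOp f‖ ≤ 1 ∧ (f : X → ℂ) x₀ = 0 ∧ (f : X → ℂ) x₁ = r := by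
  obtain ⟨Φ, hΦ, hn⟩ := hnp 1 2 ![x₀, x₁] ![0, Matrix.of fun _ _ => (r : ℂ)] (by
    refine posSemidef_of_eq_inner (fun _ => kerVec H x₀) ?_
    have hrC : (1 - (r : ℂ) * r) * ker H x₁ x₁ = 1 := by
      rw [ker_self]
      have : (1 - r * r) * ‖kerVec H x₁‖ ^ 2 = 1 := by linarith
      exact_mod_cast this
    have h01 : ker H x₀ x₁ = 1 := by rw [← conj_ker, hx₀, map_one]
    have h00 : ∀ x, ker H x x₀ = 1 := hx₀
    rintro ⟨i, a⟩ ⟨j, b⟩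
    rw [inner_kerVec_kerVec, hx₀]
    fin_cases a
    fin_cases b
    fin_cases i <;> fin_cases j <;> simp [h00, h01, Matrix.mul_apply, hrC])
  refine ⟨Φ 0 0, (norm_mulOp_le_norm_matMulOp Φ 0 0).trans hn, ?_, ?_⟩
  · simpa using congrFun (congrFun (hΦ 0) 0) 0
  · simpa using congrFun (congrFun (hΦ 1) 0) 0

/-- If `f` vanishes at `x₀` and is extremal at `x₁`, there is a contractive row `(φ, g)` of
multipliers such that `φ` agrees with `f` at `x₀` and `x₁`, and `g x₂` is as large as the Schwarz
lemma at `x₂` allows for a row with first entry `f`. -/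
theorem exists_row_multiplier {x₀ x₁ x₂ : X} (hx₀ : IsNormalizedAt H x₀)
    (hirr : IsIrreducible H) (hnp : IsCompleteNevanlinnaPick H) {f : Mult H}
    (h11 : (1 - (f : X → ℂ) x₁ * conj ((f : X → ℂ) x₁)) * ker H x₁ x₁ = 1)
    (h12 : (1 - (f : X → ℂ) x₁ * conj ((f : X → ℂ) x₂)) * ker H x₁ x₂ = 1) {s : ℝ}
    (h22 : (1 - (f : X → ℂ) x₂ * conj ((f : X → ℂ) x₂) - s * s) * ker H x₂ x₂ = 1) :
    ∃ φ g : Mult H, ‖mulOp φ‖ ≤ 1 ∧ (∀ x, ‖(φ : X → ℂ) x‖ ^ 2 + ‖(g : X → ℂ) x‖ ^ 2 ≤ 1) ∧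
      (φ : X → ℂ) x₀ = 0 ∧ (φ : X → ℂ) x₁ = (f : X → ℂ) x₁ ∧ (g : X → ℂ) x₂ = s := by
  obtain ⟨Φ, hΦ, hn⟩ := hnp 2 3 ![x₀, x₁, x₂]
    ![0, !![(f : X → ℂ) x₁, 0; 0, 0], !![(f : X → ℂ) x₂, (s : ℂ); 0, 0]] (by
    -- the Pick matrix is the direct sum of the all-ones matrix and the kernel matrix
    refine posSemidef_of_eq_inner (E := PiLp 2 fun _ : Fin 2 => H)
      (fun p => PiLp.single 2 p.2 (![kerVec H x₀, kerVec H (![x₀, x₁, x₂] p.1)] p.2)) ?_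
    have h01 : ∀ x, ker H x₀ x = 1 := fun x => by rw [← conj_ker, hx₀, map_one]
    have h21 : (1 - (f : X → ℂ) x₂ * conj ((f : X → ℂ) x₁)) * ker H x₂ x₁ = 1 := by
      have := congrArg conj h12
      simpa [conj_ker, mul_comm] using this
    have h00 : ∀ x, ker H x x₀ = 1 := hx₀
    rintro ⟨i, a⟩ ⟨j, b⟩
    fin_cases a <;> fin_cases b <;> fin_cases i <;> fin_cases j <;>
      simp [-inner_self_eq_norm_sq_to_K, PiLp.inner_apply, inner_kerVec_kerVec, h01, h00,
        Matrix.mul_apply, h11, h12, h21, ← sub_sub, h22])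
  refine ⟨Φ 0 0, Φ 0 1, (norm_mulOp_le_norm_matMulOp Φ 0 0).trans hn, fun x => ?_, ?_, ?_, ?_⟩
  · simpa [Fin.sum_univ_two] using sum_norm_sq_apply_le_one hn 0 (hirr.1 x x)
  · simpa using congrFun (congrFun (hΦ 0) 0) 0
  · simpa using congrFun (congrFun (hΦ 1) 0) 0
  · simpa using congrFun (congrFun (hΦ 2) 0) 1

/-- The kernel of a space of weak Hardy type is `1 / (1 - f(x) conj f(y))` for a multiplier `f`
with values in the unit disk. -/
theorem exists_ker_eq_szego [Nontrivial X] {x₀ : X} (hx₀ : IsNormalizedAt H x₀)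
    (hH : IsWeakHardyType H) :
    ∃ f : Mult H, (f : X → ℂ) x₀ = 0 ∧ (∀ x, ‖(f : X → ℂ) x‖ < 1) ∧
      ∀ x y, ker H x y = 1 / (1 - (f : X → ℂ) x * conj ((f : X → ℂ) y)) := by
  obtain ⟨-, hirr, hnp, hsup⟩ := hH
  obtain ⟨x₁, hx₁⟩ := exists_ne x₀
  have hκ := one_lt_norm_kerVec_sq hx₀ hirr hx₁
  set κ : ℝ := ‖kerVec H x₁‖ ^ 2 with hκdef
  have hr2 : 0 < 1 - κ⁻¹ := sub_pos.2 (inv_lt_one_of_one_lt₀ hκ)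
  obtain ⟨r, hr0, hr⟩ : ∃ r : ℝ, 0 < r ∧ r ^ 2 * κ = κ - 1 :=
    ⟨√(1 - κ⁻¹), Real.sqrt_pos.2 hr2, by
      rw [Real.sq_sqrt hr2.le, sub_mul, inv_mul_cancel₀ (by positivity), one_mul]⟩
  obtain ⟨f, hf, hf0, hf1⟩ := exists_extremal_multiplier hx₀ hnp hr
  have heq : ∀ φ : Mult H, ‖mulOp φ‖ ≤ 1 → (φ : X → ℂ) x₀ = 0 → (φ : X → ℂ) x₁ = r →
      ∀ y, r * conj ((φ : X → ℂ) y) * ker H x₁ y = ker H x₁ y - 1 := by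
    intro φ hφ h0 h1 y
    rw [← h1]
    refine apply_mul_conj_apply_mul_ker hx₀ hφ h0 ?_ y
    rw [h1, Complex.norm_real, Real.norm_of_nonneg hr0.le]
    exact hr
  -- uniqueness of the extremal multiplier
  have huniq : ∀ φ : Mult H, ‖mulOp φ‖ ≤ 1 → (φ : X → ℂ) x₀ = 0 → (φ : X → ℂ) x₁ = r →
      φ = f := by
    intro φ hφ h0 h1
    refine Subtype.ext (funext fun y => ?_)
    have h2 := (heq φ hφ h0 h1 y).trans (heq f hf hf0 hf1 y).symm
    have h3 := mul_left_cancel₀ (by exact_mod_cast hr0.ne') (mul_right_cancel₀ (hirr.1 _ _) h2)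
    exact (starRingEnd ℂ).injective h3
  have hfy : ∀ y, (1 - (f : X → ℂ) x₁ * conj ((f : X → ℂ) y)) * ker H x₁ y = 1 := fun y => by
    rw [hf1]
    linear_combination -heq f hf hf0 hf1 y
  -- `r f k_{x₁} = k_{x₁} - 1`, so `f` preserves the norm of `k_{x₁}`
  have hfk : ‖mulOp f (kerVec H x₁)‖ = ‖kerVec H x₁‖ := by
    have e : (r : ℂ) • mulOp f (kerVec H x₁) = kerVec H x₁ - kerVec H x₀ := by
      refine RKHS.ext (𝕜 := ℂ) fun y => ?_
      rw [RKHS.coe_smul, RKHS.coe_sub, Pi.smul_apply, Pi.sub_apply, mulOp_apply, kerVec_apply,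
        kerVec_apply, hx₀, smul_eq_mul]
      have := congrArg conj (heq f hf hf0 hf1 y)
      simpa [conj_ker, mul_assoc] using this
    have e2 := congrArg (fun v => ‖v‖ ^ 2) e
    simp only [norm_smul, mul_pow, norm_kerVec_sub_sq hx₀, Complex.norm_real, Real.norm_eq_abs,
      sq_abs] at e2
    rw [← hκdef, ← hr] at e2
    rw [← sq_eq_sq₀ (norm_nonneg _) (norm_nonneg _)]
    exact mul_left_cancel₀ (by positivity) e2
  have hdiag : ∀ x, ‖(f : X → ℂ) x‖ ^ 2 * ‖kerVec H x‖ ^ 2 = ‖kerVec H x‖ ^ 2 - 1 := by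
    intro x₂
    have hle := norm_sq_mul_le_of_apply_eq_zero hx₀ hf hf0 x₂
    set t : ℝ := ‖kerVec H x₂‖ ^ 2 with ht
    have ht0 : 0 < t := by
      have h := hirr.1 x₂ x₂
      rw [ker_self, ← ht] at h
      exact (sq_nonneg _).lt_of_ne' (by exact_mod_cast h)
    -- with this `s`, the row `(f x₂, s)` has the largest norm that the Schwarz lemma allows at `x₂`
    set s : ℝ := √((t - 1 - ‖(f : X → ℂ) x₂‖ ^ 2 * t) / t) with hs
    have hs2 : s ^ 2 * t = t - 1 - ‖(f : X → ℂ) x₂‖ ^ 2 * t := by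
      rw [hs, Real.sq_sqrt (div_nonneg (by linarith) ht0.le), div_mul_cancel₀ _ ht0.ne']
    obtain ⟨φ, g, hφ, hφg, hφ0, hφ1, hg⟩ := exists_row_multiplier hx₀ hirr hnp (f := f) (x₂ := x₂)
      (hfy x₁) (hfy x₂) (s := s) (by
        rw [ker_self, ← ht, Complex.mul_conj, Complex.normSq_eq_norm_sq]
        have : (1 - ‖(f : X → ℂ) x₂‖ ^ 2 - s * s) * t = 1 := by linarith
        exact_mod_cast this)
    obtain rfl := huniq φ hφ hφ0 (hφ1.trans hf1)
    have hs0 := eq_zero_of_norm_sq_add_norm_sq_le_one hsup hφg (h := kerVec H x₁)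
      (fun x => hirr.1 _ _) hfk x₂
    rw [hg, Complex.ofReal_eq_zero] at hs0
    rw [hs0] at hs2
    linarith
  have hker : ∀ x y, (1 - (f : X → ℂ) x * conj ((f : X → ℂ) y)) * ker H x y = 1 := fun x y => by
    linear_combination -apply_mul_conj_apply_mul_ker hx₀ hf hf0 (hdiag x) y
  refine ⟨f, hf0, fun x => ?_, fun x y => ?_⟩
  · have h1 := hdiag x
    have h2 : 0 < ‖kerVec H x‖ ^ 2 := by
      have h := hirr.1 x x
      rw [ker_self] at h
      exact (sq_nonneg _).lt_of_ne' (by exact_mod_cast h)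
    by_contra h3
    have h4 : 1 ≤ ‖(f : X → ℂ) x‖ ^ 2 := one_le_pow₀ (not_lt.1 h3)
    nlinarith
  · exact eq_one_div_of_mul_eq_one_right (hker x y)

end RankOne

section Hardy

/-! ### Elements of the Hardy space -/

namespace HardySpace

/-- The element of the Hardy space with given square summable Taylor coefficients. -/
def ofCoeff (a : ℕ → ℂ) (ha : Memℓp a 2) : HardySpace := (⟨a, ha⟩ : lp (fun _ : ℕ => ℂ) 2)

@[simp]
theorem taylorCoeff_ofCoeff (a : ℕ → ℂ) (ha : Memℓp a 2) : (ofCoeff a ha).taylorCoeff = a := rfl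

theorem ext_taylorCoeff {f g : HardySpace} (h : ∀ n, f.taylorCoeff n = g.taylorCoeff n) :
    f = g :=
  lp.ext (E := fun _ : ℕ => ℂ) (funext h)

theorem hasSum_norm_sq (f : HardySpace) : HasSum (fun n => ‖f.taylorCoeff n‖ ^ 2) (‖f‖ ^ 2) := by
  have h := lp.hasSum_norm (E := fun _ : ℕ => ℂ) (p := 2) (by norm_num)
    (show lp (fun _ : ℕ => ℂ) 2 from f)
  simp only [ENNReal.toReal_ofNat, Real.rpow_ofNat] at h
  exact h

theorem hasSum_inner (f g : HardySpace) :
    HasSum (fun n => conj (f.taylorCoeff n) * g.taylorCoeff n) (inner ℂ f g) := by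
  have h := lp.hasSum_inner (𝕜 := ℂ) (show lp (fun _ : ℕ => ℂ) 2 from f)
    (show lp (fun _ : ℕ => ℂ) 2 from g)
  simp only [RCLike.inner_apply'] at h
  exact h

theorem memℓp_of_summable {a : ℕ → ℂ} (ha : Summable fun n => ‖a n‖ ^ 2) : Memℓp a 2 :=
  memℓp_gen (by simpa using ha)

theorem summable_norm_sq (f : HardySpace) : Summable fun n => ‖f.taylorCoeff n‖ ^ 2 :=
  f.hasSum_norm_sq.summable

theorem kerVec_eq_szego (z : 𝔻) : kerVec HardySpace z = szego z := by
  refine ext_inner_right ℂ fun f => ?_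
  rw [inner_kerVec]
  exact (hasSum_apply f z).unique (hasSum_inner_szego f z)

/-- The holomorphic function on the open unit disk given by an element of the Hardy space,
extended to the plane by the sum of the Taylor series (`0` where the series is not
summable). -/
def extend (f : HardySpace) (z : ℂ) : ℂ := ∑' n, f.taylorCoeff n * z ^ n

theorem extend_coe (f : HardySpace) (z : 𝔻) : f.extend z = f z := (f.hasSum_apply z).tsum_eq

theorem differentiableOn_extend (f : HardySpace) :
    DifferentiableOn ℂ f.extend (Metric.ball 0 1) := by
  let p : FormalMultilinearSeries ℂ ℂ ℂ := .ofScalars ℂ f.taylorCoeff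
  have hp : HasFPowerSeriesOnBall f.extend p 0 1 := by
    refine ⟨?_, one_pos, fun {y} hy => ?_⟩
    · refine p.le_radius_of_bound (r := 1) ‖f‖ fun n => ?_
      have h1 : ‖f.taylorCoeff n‖ ≤ ‖f‖ :=
        lp.norm_apply_le_norm (by norm_num) (show lp (fun _ : ℕ => ℂ) 2 from f) n
      have h2 : ‖p n‖ = ‖f.taylorCoeff n‖ :=
        FormalMultilinearSeries.ofScalars_norm (E := ℂ) f.taylorCoeff n
      rw [h2]
      simpa using h1
    · have hy1 : ‖y‖ < 1 := by
        have h1 : ‖y‖ₑ < 1 := by simpa using hy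
        rw [← ofReal_norm, ENNReal.ofReal_lt_one] at h1
        exact h1
      have h1 := hasSum_apply f (.mk y hy1)
      rw [← extend_coe] at h1
      have e : (fun n => f.taylorCoeff n * y ^ n) = fun n => p n fun _ => y := by
        funext n
        simp [p, mul_comm]
      rw [zero_add, ← e]
      exact h1
  have h := hp.differentiableOn
  intro z hz
  refine (h z ?_).mono ?_
  · simpa [Metric.mem_eball, ← ofReal_norm] using hz
  · intro w hw
    simpa [Metric.mem_eball, ← ofReal_norm] using hw

/-! ### Bounded holomorphic functions as multipliers of the Hardy space -/

/-- A polynomial as an element of the Hardy space. -/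
def ofPolynomial (p : Polynomial ℂ) : HardySpace :=
  ofCoeff p.coeff (memℓp_of_summable (summable_of_ne_finset_zero (s := p.support) (by
    intro n hn
    simp [Polynomial.notMem_support_iff.1 hn])))

theorem ofPolynomial_apply (p : Polynomial ℂ) (z : 𝔻) : ofPolynomial p z = p.eval (z : ℂ) := by
  rw [Polynomial.eval_eq_sum, Polynomial.sum]
  refine (hasSum_apply _ z).unique (hasSum_sum_of_ne_finset_zero fun n hn => ?_)
  simp [ofPolynomial, Polynomial.notMem_support_iff.1 hn]

theorem norm_sq_ofPolynomial (p : Polynomial ℂ) :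
    ‖ofPolynomial p‖ ^ 2 = ∑ n ∈ p.support, ‖p.coeff n‖ ^ 2 := by
  refine (hasSum_norm_sq _).unique (hasSum_sum_of_ne_finset_zero fun n hn => ?_)
  simp [ofPolynomial, Polynomial.notMem_support_iff.1 hn]

/-- Multiplication by a polynomial, bounded by Parseval's identity on the unit circle. -/
theorem norm_ofPolynomial_mul_le {p : Polynomial ℂ} {C : ℝ}
    (hp : ∀ z : ℂ, ‖z‖ ≤ 1 → ‖p.eval z‖ ≤ C) (q : Polynomial ℂ) :
    ‖ofPolynomial (p * q)‖ ≤ C * ‖ofPolynomial q‖ := by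
  have hC : 0 ≤ C := (norm_nonneg _).trans (hp 0 (by simp))
  have hc : ∀ p : Polynomial ℂ, CircleIntegrable (fun θ => ‖p.eval θ‖ ^ 2) 0 1 := fun p => by
    refine ContinuousOn.circleIntegrable' ?_
    fun_prop
  rw [← sq_le_sq₀ (norm_nonneg _) (by positivity), mul_pow, norm_sq_ofPolynomial,
    norm_sq_ofPolynomial, Polynomial.sum_sq_norm_coeff_eq_circleAverage,
    Polynomial.sum_sq_norm_coeff_eq_circleAverage, ← smul_eq_mul (C ^ 2), ← Real.circleAverage_smul]
  refine Real.circleAverage_mono (hc _) ((hc q).const_smul (a := C ^ 2)) fun z hz => ?_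
  have hz1 : ‖z‖ ≤ 1 := by simpa using (mem_sphere_zero_iff_norm.1 hz).le
  simp only [Polynomial.eval_mul, norm_mul, mul_pow, Pi.smul_apply, smul_eq_mul]
  have := hp z hz1
  gcongr

/-- Dilations of a holomorphic function are uniform limits of polynomials. -/
theorem exists_polynomial_norm_sub_le {Φ : ℂ → ℂ}
    (hΦ : DifferentiableOn ℂ Φ (Metric.ball 0 1)) {r ε : ℝ} (hr0 : 0 ≤ r) (hr : r < 1)
    (hε : 0 < ε) :
    ∃ p : Polynomial ℂ, ∀ z : ℂ, ‖z‖ ≤ 1 → ‖Φ (r * z) - p.eval z‖ ≤ ε := by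
  obtain ⟨s, hrs, hs⟩ := exists_between hr
  obtain ⟨t, hst, ht⟩ := exists_between hs
  have hs0 : 0 < s := hr0.trans_lt hrs
  lift s to NNReal using hs0.le
  lift t to NNReal using (hs0.trans hst).le
  have h1 : HasFPowerSeriesOnBall Φ (cauchyPowerSeries Φ 0 t) 0 t :=
    (hΦ.mono (Metric.closedBall_subset_ball ht)).hasFPowerSeriesOnBall
      (by exact_mod_cast hs0.trans hst)
  have h2 := h1.tendstoUniformlyOn (r' := s) (by exact_mod_cast hst)
  rw [Metric.tendstoUniformlyOn_iff] at h2
  obtain ⟨n, hn⟩ := (h2 ε hε).exists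
  refine ⟨∑ k ∈ Finset.range n,
    Polynomial.monomial k ((r : ℂ) ^ k * (cauchyPowerSeries Φ 0 t).coeff k), fun z hz => ?_⟩
  have h3 := hn (r * z) (by
    rw [mem_ball_zero_iff, norm_mul, Complex.norm_real, Real.norm_of_nonneg hr0]
    exact (mul_le_of_le_one_right hr0 hz).trans_lt hrs)
  rw [zero_add, dist_eq_norm] at h3
  refine le_of_eq_of_le ?_ h3.le
  congr 2
  rw [FormalMultilinearSeries.partialSum, Polynomial.eval_finsetSum]
  refine Finset.sum_congr rfl fun k _ => ?_
  rw [Polynomial.eval_monomial, FormalMultilinearSeries.apply_eq_pow_smul_coeff, smul_eq_mul]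
  ring

/-- The Taylor polynomial of degree less than `n`. -/
def truncate (f : HardySpace) (n : ℕ) : Polynomial ℂ :=
  ∑ k ∈ Finset.range n, Polynomial.monomial k (f.taylorCoeff k)

theorem coeff_truncate (f : HardySpace) (n k : ℕ) :
    (f.truncate n).coeff k = if k < n then f.taylorCoeff k else 0 := by
  simp [truncate, Polynomial.coeff_monomial]

theorem norm_ofPolynomial_truncate_le (f : HardySpace) (n : ℕ) :
    ‖ofPolynomial (f.truncate n)‖ ≤ ‖f‖ := by
  rw [← sq_le_sq₀ (norm_nonneg _) (norm_nonneg _)]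
  refine hasSum_le (fun k => ?_) (hasSum_norm_sq _) (hasSum_norm_sq f)
  simp only [ofPolynomial, taylorCoeff_ofCoeff, coeff_truncate]
  split_ifs
  · exact le_rfl
  · simp

theorem tendsto_eval_truncate (f : HardySpace) (z : 𝔻) :
    Filter.Tendsto (fun n => (f.truncate n).eval (z : ℂ)) Filter.atTop (nhds (f z)) := by
  refine (f.hasSum_apply z).tendsto_sum_nat.congr fun n => ?_
  simp [truncate, Polynomial.eval_finsetSum]

/-- A holomorphic function bounded by `C` on the disk multiplies the Hardy space into itself, with
norm at most `C`. -/
theorem exists_eq_mul {Φ : ℂ → ℂ} (hΦ : DifferentiableOn ℂ Φ (Metric.ball 0 1)) {C : ℝ}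
    (hC : ∀ z ∈ Metric.ball (0 : ℂ) 1, ‖Φ z‖ ≤ C) (f : HardySpace) :
    ∃ g : HardySpace, (∀ z : 𝔻, g z = Φ z * f z) ∧ ‖g‖ ≤ C * ‖f‖ := by
  set ε : ℕ → ℝ := fun n => 1 / ((n : ℝ) + 1) with hε
  have hε0 : ∀ n, 0 < ε n := fun n => by positivity
  have hε1 : ∀ n, ε n ≤ 1 := fun n => by
    rw [hε]
    exact div_le_one_of_le₀ (by simp) (by positivity)
  have hεt : Filter.Tendsto ε Filter.atTop (nhds 0) := tendsto_one_div_add_atTop_nhds_zero_nat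
  have hr : ∀ n z, ‖z‖ ≤ 1 → ‖((1 - ε n : ℝ) : ℂ) * z‖ < 1 := fun n z hz => by
    rw [norm_mul, Complex.norm_real, Real.norm_of_nonneg (sub_nonneg.2 (hε1 n))]
    exact (mul_le_of_le_one_right (sub_nonneg.2 (hε1 n)) hz).trans_lt (by linarith [hε0 n])
  choose p hp using fun n => exists_polynomial_norm_sub_le hΦ (r := 1 - ε n) (ε := ε n)
    (sub_nonneg.2 (hε1 n)) (by linarith [hε0 n]) (hε0 n)
  have hpC : ∀ n z, ‖z‖ ≤ 1 → ‖(p n).eval z‖ ≤ C + ε n := fun n z hz => by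
    have h1 := hC _ (mem_ball_zero_iff.2 (hr n z hz))
    have h2 := norm_sub_norm_le ((p n).eval z) (Φ ((1 - ε n : ℝ) * z))
    rw [norm_sub_rev] at h2
    linarith [hp n z hz]
  refine exists_eq_of_tendsto_apply (f := fun n => ofPolynomial (p n * f.truncate n))
    (C := fun n => (C + ε n) * ‖f‖) (fun n => ?_) ?_ fun z => ?_
  · refine (norm_ofPolynomial_mul_le (hpC n) _).trans ?_
    refine mul_le_mul_of_nonneg_left (f.norm_ofPolynomial_truncate_le n) ?_
    exact (norm_nonneg _).trans (hpC n 0 (by simp))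
  · simpa using (hεt.const_add C).mul_const ‖f‖
  · simp_rw [ofPolynomial_apply, Polynomial.eval_mul]
    refine Filter.Tendsto.mul ?_ (f.tendsto_eval_truncate z)
    have h1 : Filter.Tendsto (fun n => Φ ((1 - ε n : ℝ) * z)) Filter.atTop (nhds (Φ z)) := by
      have hc : ContinuousAt Φ z := (hΦ.continuousOn).continuousAt
        (Metric.isOpen_ball.mem_nhds (mem_ball_zero_iff.2 z.norm_lt_one))
      refine hc.tendsto.comp ?_
      have h2 : Filter.Tendsto (fun n => 1 - ε n) Filter.atTop (nhds 1) := by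
        simpa using hεt.const_sub 1
      have h3 := ((Complex.continuous_ofReal.tendsto 1).comp h2).mul_const (z : ℂ)
      simpa using h3
    have h2 : Filter.Tendsto (fun n => Φ ((1 - ε n : ℝ) * z) - (p n).eval (z : ℂ)) Filter.atTop
        (nhds 0) := squeeze_zero_norm (fun n => hp n z z.norm_lt_one.le) hεt
    simpa using h1.sub h2

end HardySpace

end Hardy

section Beurling

/-! ### Zero sets of the Hardy space -/

namespace HardySpace

/-- Multiplication by the coordinate function. -/
def shift (f : HardySpace) : HardySpace :=
  ofCoeff (fun n => Nat.casesOn n 0 f.taylorCoeff) (memℓp_of_summable (by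
    rw [← summable_nat_add_iff 1]
    exact f.summable_norm_sq))

@[simp]
theorem taylorCoeff_shift_zero (f : HardySpace) : f.shift.taylorCoeff 0 = 0 := rfl

@[simp]
theorem taylorCoeff_shift_succ (f : HardySpace) (n : ℕ) :
    f.shift.taylorCoeff (n + 1) = f.taylorCoeff n := rfl

theorem shift_apply (f : HardySpace) (z : 𝔻) : f.shift z = z * f z := by
  refine (hasSum_apply _ z).unique ((hasSum_nat_add_iff' 1).1 ?_)
  have h := (f.hasSum_apply z).mul_left (z : ℂ)
  simpa [pow_succ', mul_left_comm] using h

theorem inner_shift_shift (f g : HardySpace) : inner ℂ f.shift g.shift = inner ℂ f g := by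
  refine (hasSum_inner _ _).unique ((hasSum_nat_add_iff' 1).1 ?_)
  simpa using hasSum_inner f g

theorem iterate_shift_apply (f : HardySpace) (n : ℕ) (z : 𝔻) :
    shift^[n] f z = (z : ℂ) ^ n * f z := by
  induction n with
  | zero => simp
  | succ n ih => rw [Function.iterate_succ_apply', shift_apply, ih, pow_succ', mul_assoc]

theorem taylorCoeff_iterate_shift (f : HardySpace) {n m : ℕ} (h : ∀ k < m, f.taylorCoeff k = 0)
    (hn : n ≠ 0) : (shift^[n] f).taylorCoeff m = 0 := by
  induction n, Nat.one_le_iff_ne_zero.2 hn using Nat.le_induction generalizing m with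
  | base =>
    cases m with
    | zero => simp
    | succ m => simpa using h m m.lt_succ_self
  | succ n hn ih =>
    rw [Function.iterate_succ_apply']
    cases m with
    | zero => simp
    | succ m => exact ih (fun k hk => h k (hk.trans m.lt_succ_self)) (by omega)

theorem orthonormal_iterate_shift {θ : HardySpace} (h1 : ‖θ‖ = 1)
    (h : ∀ n, n ≠ 0 → inner ℂ θ (shift^[n] θ) = 0) : Orthonormal ℂ fun n => shift^[n] θ := by
  have hs : ∀ k (f g : HardySpace), inner ℂ (shift^[k] f) (shift^[k] g) = inner ℂ f g := by
    intro k
    induction k with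
    | zero => simp
    | succ k ih => intro f g; simp only [Function.iterate_succ_apply, ih, inner_shift_shift]
  have hlt : ∀ a b, a < b → inner ℂ (shift^[a] θ) (shift^[b] θ) = 0 := by
    intro a b hab
    obtain ⟨c, rfl⟩ := Nat.exists_eq_add_of_lt hab
    rw [add_assoc, Function.iterate_add_apply, hs]
    exact h _ (by omega)
  rw [orthonormal_iff_ite]
  intro a b
  rcases lt_trichotomy a b with hab | rfl | hab
  · rw [if_neg hab.ne, hlt a b hab]
  · rw [if_pos rfl, hs, inner_self_eq_norm_sq_to_K, h1]
    simp
  · rw [if_neg hab.ne', ← inner_conj_symm, hlt b a hab, map_zero]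

/-- A unit vector orthogonal to its proper shifts is an inner function; in particular it is
bounded by one. The bound comes from evaluating `p θ`, for `p` a section of the Szegő kernel. -/
theorem norm_apply_le_one_of_inner_iterate_shift {θ : HardySpace} (h1 : ‖θ‖ = 1)
    (h : ∀ n, n ≠ 0 → inner ℂ θ (shift^[n] θ) = 0) (z : 𝔻) : ‖θ z‖ ≤ 1 := by
  have ho := orthonormal_iterate_shift h1 h
  set K : ℝ := ‖szego z‖ ^ 2 with hK
  have hsum : HasSum (fun k : ℕ => (‖(z : ℂ)‖ ^ 2) ^ k) K := by
    refine (hasSum_norm_sq (szego z)).congr_fun fun k => ?_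
    have : (szego z).taylorCoeff k = conj (z : ℂ) ^ k := rfl
    rw [this, norm_pow, RCLike.norm_conj, ← pow_mul, ← pow_mul, mul_comm]
  have hK0 : 0 < K := by
    refine (zero_lt_one).trans_le ?_
    simpa using le_hasSum hsum 0 fun k _ => by positivity
  have hbound : ∀ n, (∑ k ∈ Finset.range n, (‖(z : ℂ)‖ ^ 2) ^ k) * ‖θ z‖ ^ 2 ≤ K := by
    intro n
    set s : ℝ := ∑ k ∈ Finset.range n, (‖(z : ℂ)‖ ^ 2) ^ k with hs
    set w : HardySpace := ∑ k ∈ Finset.range n, conj (z : ℂ) ^ k • shift^[k] θ with hw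
    have hw1 : ‖w‖ ^ 2 = s := by
      have h2 := ho.inner_sum (fun k => conj (z : ℂ) ^ k) (fun k => conj (z : ℂ) ^ k)
        (Finset.range n)
      rw [← hw, inner_self_eq_norm_sq_to_K] at h2
      have h3 : (s : ℂ) = ∑ k ∈ Finset.range n, conj (conj (z : ℂ) ^ k) * conj (z : ℂ) ^ k := by
        rw [hs]
        push_cast
        refine Finset.sum_congr rfl fun k _ => ?_
        rw [← map_pow, Complex.conj_conj, Complex.mul_conj, Complex.normSq_eq_norm_sq, norm_pow]
        push_cast
        ring
      rw [← h3] at h2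
      refine Complex.ofReal_injective ?_
      rw [← h2]
      simp
    have hw2 : w z = s * θ z := by
      rw [← inner_kerVec, hw, inner_sum, hs]
      push_cast
      rw [Finset.sum_mul]
      refine Finset.sum_congr rfl fun k _ => ?_
      rw [inner_smul_right, inner_kerVec, iterate_shift_apply, ← mul_assoc, ← mul_pow,
        mul_comm (conj (z : ℂ)), Complex.mul_conj, Complex.normSq_eq_norm_sq]
      push_cast
      rfl
    have hs0 : 0 ≤ s := by positivity
    have h4 := norm_inner_le_norm (𝕜 := ℂ) (szego z) w
    rw [← kerVec_eq_szego, inner_kerVec, kerVec_eq_szego, hw2, norm_mul, Complex.norm_real,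
      Real.norm_of_nonneg hs0] at h4
    have h5 : (s * ‖θ z‖) ^ 2 ≤ (‖szego z‖ * ‖w‖) ^ 2 := by gcongr
    rw [mul_pow, mul_pow, hw1, ← hK] at h5
    rcases hs0.eq_or_lt with h6 | h6
    · rw [← h6, zero_mul]
      exact hK0.le
    · refine le_of_mul_le_mul_left ?_ h6
      linarith
  have h6 : K * ‖θ z‖ ^ 2 ≤ K :=
    le_of_tendsto' (hsum.tendsto_sum_nat.mul_const _) hbound
  have h7 : ‖θ z‖ ^ 2 ≤ 1 := le_of_mul_le_mul_left (by linarith) hK0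
  exact (sq_le_one_iff₀ (norm_nonneg _)).1 h7

/-- If a nonzero element of the Hardy space vanishes on `A`, so does a nonzero bounded one. The latter
is the extremal function `θ` of the space `N` of functions that vanish on `A`: it represents on `N`
the first Taylor coefficient that is not identically zero on `N`, a functional that
vanishes on `z N`. -/
theorem exists_bounded_eq_zero {A : Set 𝔻} {f : HardySpace} (hf : f ≠ 0)
    (hA : ∀ z ∈ A, f z = 0) :
    ∃ θ : HardySpace, θ ≠ 0 ∧ (∀ z ∈ A, θ z = 0) ∧ ∀ z, ‖θ z‖ ≤ 1 := by
  classical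
  let N : Submodule ℂ HardySpace := ⨅ z ∈ A, (ℂ ∙ kerVec HardySpace z)ᗮ
  have hmem : ∀ g : HardySpace, g ∈ N ↔ ∀ z ∈ A, g z = 0 := fun g => by
    simp [N, Submodule.mem_iInf, Submodule.mem_orthogonal_singleton_iff_inner_right, inner_kerVec]
  have hNc : IsClosed (N : Set HardySpace) := by
    simp only [N, Submodule.coe_iInf]
    exact isClosed_biInter fun z _ => Submodule.isClosed_orthogonal _
  have : CompleteSpace N := hNc.completeSpace_coe
  have hex : ∃ m, ∃ g ∈ N, g.taylorCoeff m ≠ 0 := by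
    by_contra! h
    exact hf (ext_taylorCoeff fun n => h n f ((hmem f).2 hA))
  set m := Nat.find hex
  obtain ⟨g, hgN, hg⟩ := Nat.find_spec hex
  have hmin : ∀ g ∈ N, ∀ k < m, g.taylorCoeff k = 0 := fun g hg k hk => by
    by_contra h
    exact Nat.find_min hex hk ⟨g, hg, h⟩
  -- the coordinate vector `z ^ m`
  set e : HardySpace := ofPolynomial (Polynomial.X ^ m) with he
  have hinner : ∀ h : HardySpace, inner ℂ e h = h.taylorCoeff m := fun h => by
    refine (hasSum_inner e h).unique ?_
    have := hasSum_single (f := fun n => conj (e.taylorCoeff n) * h.taylorCoeff n) m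
      (fun n hn => by simp [he, ofPolynomial, Polynomial.coeff_X_pow, hn])
    simpa [he, ofPolynomial] using this
  set θ : HardySpace := N.starProjection e with hθ
  have hθN : θ ∈ N := Submodule.starProjection_apply_mem _ _
  have hθi : ∀ h ∈ N, inner ℂ θ h = h.taylorCoeff m := fun h hh => by
    rw [hθ, ← hinner, Submodule.inner_starProjection_left_eq_right,
      Submodule.starProjection_eq_self_iff.2 hh]
  have hθ0 : θ ≠ 0 := fun h => hg (by rw [← hθi g hgN, h, inner_zero_left])
  set η : HardySpace := ((‖θ‖⁻¹ : ℝ) : ℂ) • θ with hη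
  have hηN : η ∈ N := N.smul_mem _ hθN
  have hη1 : ‖η‖ = 1 := by
    rw [hη, norm_smul, Complex.norm_real, norm_inv, norm_norm,
      inv_mul_cancel₀ (norm_ne_zero_iff.2 hθ0)]
  refine ⟨η, fun h => by simp [h] at hη1, (hmem η).1 hηN,
    norm_apply_le_one_of_inner_iterate_shift hη1 fun n hn => ?_⟩
  have hsN : shift^[n] η ∈ N := (hmem _).2 fun z hz => by
    rw [iterate_shift_apply, (hmem η).1 hηN z hz, mul_zero]
  nth_rewrite 1 [hη]
  rw [inner_smul_left, hθi _ hsN, taylorCoeff_iterate_shift η (hmin η hηN) hn, mul_zero]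

/-- A nonzero function vanishing on `A` can be divided by a power of `z` so that it no longer
vanishes at `0`. -/
theorem exists_apply_zero_ne_zero {A : Set 𝔻} {f : HardySpace} (hf : f ≠ 0)
    (hA : ∀ z ∈ A, f z = 0) :
    ∃ g : HardySpace, g 0 ≠ 0 ∧ ∀ z ∈ A, z ≠ 0 → g z = 0 := by
  classical
  have hex : ∃ m, f.taylorCoeff m ≠ 0 := by
    by_contra! h
    exact hf (ext_taylorCoeff h)
  set m := Nat.find hex
  let g : HardySpace := ofCoeff (fun n => f.taylorCoeff (n + m))
    (memℓp_of_summable ((summable_nat_add_iff m).2 f.summable_norm_sq))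
  have hfg : ∀ z : 𝔻, f z = (z : ℂ) ^ m * g z := fun z => by
    refine (f.hasSum_apply z).unique ((hasSum_nat_add_iff' m).1 ?_)
    rw [Finset.sum_eq_zero fun k hk => by
      rw [not_not.1 (Nat.find_min hex (Finset.mem_range.1 hk)), zero_mul], sub_zero]
    have h := (g.hasSum_apply z).mul_left ((z : ℂ) ^ m)
    refine h.congr_fun fun n => ?_
    simp only [g, taylorCoeff_ofCoeff]
    ring
  refine ⟨g, ?_, fun z hz hz0 => ?_⟩
  · have h0 : g 0 = g.taylorCoeff 0 := by
      refine (g.hasSum_apply 0).unique ?_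
      simpa using hasSum_single (f := fun n => g.taylorCoeff n * ((0 : 𝔻) : ℂ) ^ n) 0
        fun n hn => by simp [hn]
    rw [h0]
    simpa [g] using Nat.find_spec hex
  · have h := hfg z
    rw [hA z hz] at h
    exact (mul_eq_zero.1 h.symm).resolve_left (pow_ne_zero _ (by simpa using hz0))

end HardySpace

/-- No nonzero element of the Hardy space vanishes on a dominating set. -/
theorem IsDominating.eq_zero {A : Set 𝔻} (hA : IsDominating A) {f : HardySpace}
    (hf : ∀ z ∈ A, f z = 0) : f = 0 := by
  by_contra h0
  obtain ⟨θ, hθ, hθA, hθ1⟩ := HardySpace.exists_bounded_eq_zero h0 hf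
  have h := hA θ.extend θ.differentiableOn_extend ⟨1, fun z hz => by
    have := hθ1 (.mk z (mem_ball_zero_iff.1 hz))
    rwa [← HardySpace.extend_coe] at this⟩
  refine hθ (RKHS.ext (𝕜 := ℂ) fun z => ?_)
  have h1 : ⨆ z ∈ A, ‖θ.extend (z : ℂ)‖ₑ = 0 := by
    simp only [ENNReal.iSup_eq_zero]
    intro z hz
    rw [HardySpace.extend_coe, hθA z hz, enorm_zero]
  rw [h1] at h
  have h2 := ENNReal.iSup_eq_zero.1 h.symm z
  rw [HardySpace.extend_coe, enorm_eq_zero] at h2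
  rw [h2, RKHS.coe_zero, Pi.zero_apply]

end Beurling

section Pullback

variable {H : Type*} {X : Type*} [NormedAddCommGroup H] [InnerProductSpace ℂ H]
  [CompleteSpace H] [RKHS ℂ H X ℂ]

/-! ### Composition operators from the Hardy space -/

theorem norm_sq_linearCombination {ι E : Type*} [NormedAddCommGroup E] [InnerProductSpace ℂ E]
    (v : ι → E) (c : ι →₀ ℂ) :
    ((‖Finsupp.linearCombination ℂ v c‖ ^ 2 : ℝ) : ℂ) =
      c.sum fun p a => c.sum fun q b => conj a * b * inner ℂ (v p) (v q) := by
  rw [Complex.ofReal_pow]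
  refine (inner_self_eq_norm_sq_to_K (𝕜 := ℂ) (Finsupp.linearCombination ℂ v c)).symm.trans ?_
  rw [Finsupp.linearCombination_apply, Finsupp.sum_inner]
  refine Finsupp.sum_congr fun p _ => ?_
  rw [Finsupp.inner_sum]
  refine Finsupp.sum_congr fun q _ => ?_
  rw [inner_smul_left, inner_smul_right, mul_assoc]

/-- Composition with `j` is a contraction `U` from the Hardy space to `H` with a contractive right
inverse `V`. The operator `V` maps the kernel function at `x` to the Szegő kernel function at `j x`;
it is isometric because both families have the same Gram matrix, and `U` is its adjoint. -/
theorem exists_comp_clm {j : X → 𝔻}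
    (hk : ∀ x y, ker H x y = 1 / (1 - (j x : ℂ) * conj (j y : ℂ))) :
    ∃ (U : HardySpace →L[ℂ] H) (V : H →L[ℂ] HardySpace), ‖U‖ ≤ 1 ∧ ‖V‖ ≤ 1 ∧
      (∀ f x, U f x = f (j x)) ∧ ∀ h, U (V h) = h := by
  obtain ⟨V, hV, hV1⟩ := exists_clm_of_norm_le (v := kerVec H (X := X))
    (w := fun x => kerVec HardySpace (j x)) topologicalClosure_span_kerVec zero_le_one (fun c => by
      rw [one_mul, ← sq_le_sq₀ (norm_nonneg _) (norm_nonneg _)]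
      refine le_of_eq (Complex.ofReal_injective ?_)
      rw [norm_sq_linearCombination, norm_sq_linearCombination]
      simp_rw [inner_kerVec_kerVec, hk, ker_hardySpace])
  have hU : ∀ f x, V.adjoint f x = f (j x) := fun f x => by
    rw [← inner_kerVec, ContinuousLinearMap.adjoint_inner_right, hV, inner_kerVec]
  refine ⟨V.adjoint, V, by rwa [LinearIsometryEquiv.norm_map], hV1, hU, fun h => ?_⟩
  have h1 : V.adjoint ∘L V = ContinuousLinearMap.id ℂ H := by
    refine ContinuousLinearMap.ext_on
      ((Submodule.dense_iff_topologicalClosure_eq_top).2 topologicalClosure_span_kerVec) ?_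
    rintro _ ⟨y, rfl⟩
    refine RKHS.ext (𝕜 := ℂ) fun x => ?_
    simp only [ContinuousLinearMap.comp_apply, ContinuousLinearMap.id_apply, hV, hU]
    rw [kerVec_apply, kerVec_apply, hk, ker_hardySpace]
  exact DFunLike.congr_fun h1 h

/-- If no nonzero element of the Hardy space vanishes on the range of `j`, then composition with
`j` is a unitary operator from the Hardy space onto `H`. -/
theorem exists_comp_linearIsometryEquiv {j : X → 𝔻}
    (hk : ∀ x y, ker H x y = 1 / (1 - (j x : ℂ) * conj (j y : ℂ)))
    (hj : ∀ f : HardySpace, (∀ x, f (j x) = 0) → f = 0) :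
    ∃ U : HardySpace ≃ₗᵢ[ℂ] H, ∀ (f : HardySpace) (x : X), U f x = f (j x) := by
  obtain ⟨U, V, hU, hV, hUj, hUV⟩ := exists_comp_clm hk
  have hVU : ∀ f, V (U f) = f := fun f => by
    rw [← sub_eq_zero]
    refine hj _ fun x => ?_
    rw [← hUj, map_sub, hUV, sub_self, RKHS.coe_zero, Pi.zero_apply]
  refine ⟨⟨LinearEquiv.ofLinearMap (U : HardySpace →ₗ[ℂ] H) V (LinearMap.ext hUV)
    (LinearMap.ext hVU), fun f => le_antisymm ?_ ?_⟩, hUj⟩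
  · exact (U.le_opNorm f).trans (mul_le_of_le_one_left (norm_nonneg _) hU)
  · have h := (V.le_opNorm (U f)).trans (mul_le_of_le_one_left (norm_nonneg _) hV)
    rwa [hVU] at h

theorem one_sub_mul_conj_ne_zero (z w : 𝔻) : 1 - (z : ℂ) * conj (w : ℂ) ≠ 0 := by
  intro h0
  have h1 : ‖(z : ℂ) * conj (w : ℂ)‖ < 1 := by
    rw [norm_mul, RCLike.norm_conj]
    exact mul_lt_one_of_nonneg_of_lt_one_left (norm_nonneg _) z.norm_lt_one w.norm_lt_one.le
  rw [← sub_eq_zero.1 h0, norm_one] at h1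
  exact lt_irrefl _ h1

theorem norm_kerVec_hardySpace_sq_pos (z : 𝔻) : 0 < ‖kerVec HardySpace z‖ ^ 2 := by
  have h0 : ker HardySpace z z ≠ 0 := by
    rw [ker_hardySpace]
    exact one_div_ne_zero (one_sub_mul_conj_ne_zero z z)
  rw [ker_self] at h0
  exact (sq_nonneg _).lt_of_ne' (by exact_mod_cast h0)

/-- If composition with `j` is unitary, then a bounded holomorphic function on the disk induces a
multiplier of `H` whose norm is the supremum over the disk. -/
theorem exists_mult_comp {j : X → 𝔻} {U : HardySpace ≃ₗᵢ[ℂ] H}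
    (hU : ∀ (f : HardySpace) (x : X), U f x = f (j x)) {Φ : ℂ → ℂ}
    (hΦ : DifferentiableOn ℂ Φ (Metric.ball 0 1)) {C : ℝ}
    (hC : ∀ z ∈ Metric.ball (0 : ℂ) 1, ‖Φ z‖ ≤ C) :
    ∃ φ : Mult H, (∀ x, (φ : X → ℂ) x = Φ (j x)) ∧ ‖mulOp φ‖ ≤ C ∧
      ∀ z : 𝔻, ‖Φ (z : ℂ)‖ ≤ ‖mulOp φ‖ := by
  have hC0 : 0 ≤ C := (norm_nonneg _).trans (hC 0 (by simp))
  choose g hg hgn using HardySpace.exists_eq_mul hΦ hC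
  have hmul : ∀ (h : H) x, U (g (U.symm h)) x = Φ (j x) * h x := fun h x => by
    rw [hU, hg, ← hU, LinearIsometryEquiv.apply_symm_apply]
  let φ : Mult H := ⟨fun x => Φ (j x), fun h => ⟨U (g (U.symm h)), hmul h⟩⟩
  have hφ : ∀ h, mulOp φ h = U (g (U.symm h)) := fun h => RKHS.ext (𝕜 := ℂ) fun x => by
    rw [mulOp_apply, hmul]
  refine ⟨φ, fun _ => rfl, ContinuousLinearMap.opNorm_le_bound _ hC0 fun h => ?_, fun z => ?_⟩
  · rw [hφ, LinearIsometryEquiv.norm_map]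
    exact (hgn _).trans_eq (by rw [LinearIsometryEquiv.norm_map])
  -- evaluate `Φ k_z` at `z`, where `k_z` is the Szegő kernel function
  · set k := kerVec HardySpace z
    have h1 : 0 < ‖k‖ ^ 2 := norm_kerVec_hardySpace_sq_pos z
    have h2 := norm_inner_le_norm (𝕜 := ℂ) k (g k)
    have h3 : ‖inner ℂ k (g k)‖ = ‖Φ z‖ * ‖k‖ ^ 2 := by
      rw [inner_kerVec, hg, norm_mul, kerVec_apply, ker_self, Complex.norm_real,
        Real.norm_of_nonneg (sq_nonneg _)]
    have h4 : ‖g k‖ ≤ ‖mulOp φ‖ * ‖k‖ := by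
      have := (mulOp φ).le_opNorm (U k)
      rwa [hφ, LinearIsometryEquiv.norm_map, LinearIsometryEquiv.norm_map,
        LinearIsometryEquiv.symm_apply_apply] at this
    rw [h3] at h2
    refine le_of_mul_le_mul_right (h2.trans ?_) h1
    calc ‖k‖ * ‖g k‖ ≤ ‖k‖ * (‖mulOp φ‖ * ‖k‖) := by gcongr
      _ = ‖mulOp φ‖ * ‖k‖ ^ 2 := by ring

/-- Every multiplier of `H` is induced by a bounded holomorphic function on the disk if composition
with `j` is unitary; on a dominating set its multiplier norm is its supremum norm. -/
theorem enorm_mulOp_eq_iSup {j : X → 𝔻} {U : HardySpace ≃ₗᵢ[ℂ] H}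
    (hU : ∀ (f : HardySpace) (x : X), U f x = f (j x)) (hA : IsDominating (Set.range j))
    {x₀ : X} (hx₀ : IsNormalizedAt H x₀) (hne : ∀ x : X, ker H x x ≠ 0) (φ : Mult H) :
    ‖mulOp φ‖ₑ = ⨆ x : X, ‖(φ : X → ℂ) x‖ₑ := by
  refine le_antisymm ?_ (iSup_le fun x => ?_)
  swap
  · rw [enorm_le_iff_norm_le]
    exact norm_apply_le_norm_mulOp φ (hne x)
  set F : HardySpace := U.symm (mulOp φ (kerVec H x₀)) with hF
  have hFj : ∀ x, F (j x) = (φ : X → ℂ) x := fun x => by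
    rw [← hU, hF, LinearIsometryEquiv.apply_symm_apply, mulOp_apply, kerVec_apply, hx₀, mul_one]
  -- `F` is bounded: evaluate `F k_z` at `z`
  have hFb : ∀ z : 𝔻, ‖F z‖ ≤ ‖mulOp φ‖ := by
    intro z
    have hsub : ∀ w ∈ Metric.ball (0 : ℂ) 1, 1 - ‖(z : ℂ)‖ ≤ ‖1 - w * conj (z : ℂ)‖ := by
      intro w hw
      have h1 := norm_sub_norm_le (1 : ℂ) (w * conj (z : ℂ))
      rw [norm_one, norm_mul, RCLike.norm_conj] at h1
      have h2 : ‖w‖ * ‖(z : ℂ)‖ ≤ ‖(z : ℂ)‖ :=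
        mul_le_of_le_one_left (norm_nonneg _) (mem_ball_zero_iff.1 hw).le
      linarith
    have hz : 0 < 1 - ‖(z : ℂ)‖ := sub_pos.2 z.norm_lt_one
    obtain ⟨g, hg, -⟩ := HardySpace.exists_eq_mul (Φ := fun w => 1 / (1 - w * conj (z : ℂ)))
      (C := 1 / (1 - ‖(z : ℂ)‖)) (by
        refine DifferentiableOn.div (by fun_prop) (by fun_prop) fun w hw h => ?_
        have := hsub w hw
        rw [h, norm_zero] at this
        linarith) (fun w hw => by
        rw [norm_div, norm_one]
        exact one_div_le_one_div_of_le hz (hsub w hw)) F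
    set k := kerVec HardySpace z
    have hg' : ∀ w : 𝔻, g w = k w * F w := fun w => by
      rw [hg, kerVec_apply, ker_hardySpace]
    have hUg : U g = mulOp φ (U k) := RKHS.ext (𝕜 := ℂ) fun x => by
      rw [hU, hg', hFj, mulOp_apply, hU, mul_comm]
    have h1 : 0 < ‖k‖ ^ 2 := norm_kerVec_hardySpace_sq_pos z
    have h2 := norm_inner_le_norm (𝕜 := ℂ) k g
    rw [inner_kerVec, hg', kerVec_apply, ker_self, norm_mul, Complex.norm_real,
        Real.norm_of_nonneg (sq_nonneg _)] at h2
    have h3 : ‖g‖ ≤ ‖mulOp φ‖ * ‖k‖ := by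
      rw [← U.norm_map g, hUg, ← U.norm_map k]
      exact (mulOp φ).le_opNorm _
    refine le_of_mul_le_mul_left (h2.trans ?_) h1
    calc ‖k‖ * ‖g‖ ≤ ‖k‖ * (‖mulOp φ‖ * ‖k‖) := by gcongr
      _ = ‖k‖ ^ 2 * ‖mulOp φ‖ := by ring
  have hdom := hA F.extend F.differentiableOn_extend ⟨‖mulOp φ‖, fun z hz => by
    have := hFb (.mk z (mem_ball_zero_iff.1 hz))
    rwa [← HardySpace.extend_coe] at this⟩
  simp only [iSup_range, HardySpace.extend_coe, hFj] at hdom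
  set S : ℝ≥0∞ := ⨆ x : X, ‖(φ : X → ℂ) x‖ₑ with hS
  have hStop : S ≠ ⊤ := by
    refine ne_top_of_le_ne_top (enorm_ne_top (x := mulOp φ)) (iSup_le fun x => ?_)
    rw [enorm_le_iff_norm_le]
    exact norm_apply_le_norm_mulOp φ (hne x)
  have hFS : ∀ z ∈ Metric.ball (0 : ℂ) 1, ‖F.extend z‖ ≤ S.toReal := fun z hz => by
    have h1 : ‖F (.mk z (mem_ball_zero_iff.1 hz))‖ₑ ≤ S := by
      rw [hdom]
      exact le_iSup (fun z : 𝔻 => ‖F z‖ₑ) _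
    rw [← HardySpace.extend_coe] at h1
    rw [← toReal_enorm]
    exact ENNReal.toReal_mono hStop h1
  obtain ⟨ψ, hψ, hψn, -⟩ := exists_mult_comp hU F.differentiableOn_extend hFS
  have hψφ : ψ = φ := Subtype.ext (funext fun x => by
    rw [hψ, HardySpace.extend_coe, hFj])
  rw [hψφ, ← toReal_enorm] at hψn
  exact (ENNReal.toReal_le_toReal enorm_ne_top hStop).1 hψn

/-- Conversely, if composition with `j` is unitary and the multiplier norm is the supremum norm,
then the range of `j` is dominating. -/
theorem isDominating_range {j : X → 𝔻} {U : HardySpace ≃ₗᵢ[ℂ] H}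
    (hU : ∀ (f : HardySpace) (x : X), U f x = f (j x))
    (hsup : ∀ φ : Mult H, ‖mulOp φ‖ₑ = ⨆ x : X, ‖(φ : X → ℂ) x‖ₑ) :
    IsDominating (Set.range j) := by
  rintro Φ hΦ ⟨C, hC⟩
  obtain ⟨φ, hφ, -, hle⟩ := exists_mult_comp hU hΦ hC
  refine le_antisymm (iSup₂_le fun z _ => le_iSup (fun z : 𝔻 => ‖Φ z‖ₑ) z) (iSup_le fun z => ?_)
  rw [iSup_range]
  simp_rw [← hφ]
  rw [← hsup, enorm_le_iff_norm_le]
  exact hle z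

/-- If the multiplier norm is the supremum norm, then the indicator function of the base point is
not in the space: it would be a contractive idempotent multiplier. -/
theorem not_exists_eq_indicator [Nontrivial X] {x₀ : X} (hx₀ : IsNormalizedAt H x₀)
    (hsup : ∀ φ : Mult H, ‖mulOp φ‖ₑ = ⨆ x : X, ‖(φ : X → ℂ) x‖ₑ) {e : H} (he : e x₀ = 1)
    (he' : ∀ x, x ≠ x₀ → e x = 0) : False := by
  have hmul : ∀ (h : H) x, (h x₀ • e) x = e x * h x := fun h x => by
    rw [RKHS.coe_smul, Pi.smul_apply, smul_eq_mul]
    rcases eq_or_ne x x₀ with rfl | hx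
    · rw [mul_comm]
    · rw [he' x hx, mul_zero, zero_mul]
  let φ : Mult H := ⟨e, fun h => ⟨h x₀ • e, hmul h⟩⟩
  have hφ : ‖mulOp φ‖ ≤ 1 := mulOp_le_one_of_apply_le hsup φ fun x => by
    change ‖e x‖ ≤ 1
    rcases eq_or_ne x x₀ with rfl | hx
    · rw [he, norm_one]
    · rw [he' x hx, norm_zero]
      exact zero_le_one
  have hφ1 : mulOp φ (kerVec H x₀) = e := RKHS.ext (𝕜 := ℂ) fun x => by
    rw [mulOp_apply, kerVec_apply, hx₀, mul_one]
  have h1 : ‖kerVec H x₀‖ ^ 2 = 1 := by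
    have := hx₀ x₀
    rw [ker_self] at this
    exact_mod_cast this
  have h2 : ‖e‖ ^ 2 ≤ 1 := by
    rw [← h1, ← hφ1]
    have := ((mulOp φ).le_opNorm (kerVec H x₀)).trans (mul_le_of_le_one_left (norm_nonneg _) hφ)
    gcongr
  have h3 : ‖kerVec H x₀ - e‖ ^ 2 ≤ 0 := by
    rw [norm_sub_sq (𝕜 := ℂ), inner_kerVec, he, h1]
    simp
    linarith
  have h4 : kerVec H x₀ = e := by
    rw [← sub_eq_zero, ← norm_eq_zero]
    exact pow_eq_zero_iff (two_ne_zero) |>.1 (le_antisymm h3 (sq_nonneg _))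
  obtain ⟨x, hx⟩ := exists_ne x₀
  have h5 := he' x hx
  rw [← h4, kerVec_apply, hx₀] at h5
  exact one_ne_zero h5

end Pullback

section Pick

open scoped MatrixOrder Matrix.Norms.L2Operator in
theorem exists_eq_conjTranspose_mul_self {ι : Type*} [Fintype ι] {M : Matrix ι ι ℂ}
    (hM : M.PosSemidef) : ∃ B : Matrix ι ι ℂ, M = B.conjTranspose * B := by
  classical
  exact CStarAlgebra.nonneg_iff_eq_star_mul_self.1 hM.nonneg

/-! ### Nevanlinna–Pick interpolation for the Szegő kernel -/

/-- Two families of vectors with the same Gram matrix are related by a linear isometry. -/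
theorem exists_linearIsometry_of_inner_eq {ι V : Type*} [NormedAddCommGroup V]
    [InnerProductSpace ℂ V] [FiniteDimensional ℂ V] {u v : ι → V}
    (h : ∀ p q, inner ℂ (u p) (u q) = inner ℂ (v p) (v q)) :
    ∃ L : V →ₗᵢ[ℂ] V, ∀ p, L (u p) = v p := by
  have hn : ∀ c : ι →₀ ℂ,
      ‖Finsupp.linearCombination ℂ v c‖ = ‖Finsupp.linearCombination ℂ u c‖ := fun c => by
    rw [← sq_eq_sq₀ (norm_nonneg _) (norm_nonneg _)]
    refine Complex.ofReal_injective ?_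
    rw [norm_sq_linearCombination, norm_sq_linearCombination]
    simp_rw [h]
  obtain ⟨g, hg⟩ := LinearMap.exists_rightInverse_of_surjective
    (Finsupp.linearCombination ℂ u).rangeRestrict
    (LinearMap.range_eq_top.2 (LinearMap.surjective_rangeRestrict _))
  have hg' : ∀ s, Finsupp.linearCombination ℂ u (g s) = s := fun s =>
    congrArg Subtype.val (DFunLike.congr_fun hg s)
  let L₀ : LinearMap.range (Finsupp.linearCombination ℂ u) →ₗᵢ[ℂ] V :=
    ⟨Finsupp.linearCombination ℂ v ∘ₗ g, fun s => by
      rw [LinearMap.comp_apply, hn, hg', Submodule.coe_norm]⟩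
  refine ⟨L₀.extend, fun p => ?_⟩
  have hp : u p ∈ LinearMap.range (Finsupp.linearCombination ℂ u) :=
    ⟨Finsupp.single p 1, by simp⟩
  refine (L₀.extend_apply ⟨u p, hp⟩).trans ?_
  change Finsupp.linearCombination ℂ v (g ⟨u p, hp⟩) = v p
  have e : v p = Finsupp.linearCombination ℂ v (Finsupp.single p 1) := by simp
  rw [e, ← sub_eq_zero, ← map_sub, ← norm_eq_zero, hn, map_sub, hg']
  simp

/-- The transfer function realization: an isometry `L` of `E ⊕ K` and a point `z` of the disk
determine for each `η` a unique `G` such that `G` is the second component of `L (η, conj z G)`. -/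
theorem existsUnique_snd_eq {E K : Type*} [NormedAddCommGroup E] [InnerProductSpace ℂ E]
    [NormedAddCommGroup K] [InnerProductSpace ℂ K] [CompleteSpace K]
    (L : WithLp 2 (E × K) →ₗᵢ[ℂ] WithLp 2 (E × K)) (z : 𝔻) (η : E) :
    ∃! G : K, (L (WithLp.toLp 2 (η, conj (z : ℂ) • G))).snd = G := by
  have hc : ContractingWith ‖(z : ℂ)‖₊
      fun G : K => (L (WithLp.toLp 2 (η, conj (z : ℂ) • G))).snd := by
    refine ⟨by exact_mod_cast z.norm_lt_one, LipschitzWith.of_dist_le_mul fun G G' => ?_⟩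
    rw [dist_eq_norm, ← WithLp.sub_snd, ← map_sub, ← WithLp.toLp_sub, Prod.mk_sub_mk, sub_self,
      ← smul_sub]
    refine (WithLp.norm_snd_le _ _).trans ?_
    rw [L.norm_map, WithLp.norm_toLp_snd, norm_smul, RCLike.norm_conj, dist_eq_norm]
    exact le_rfl
  exact ⟨hc.fixedPoint, hc.fixedPoint_isFixedPt, fun G hG => hc.fixedPoint_unique hG⟩

variable {H : Type*} {X : Type*} [NormedAddCommGroup H] [InnerProductSpace ℂ H]
  [CompleteSpace H] [RKHS ℂ H X ℂ]

/-- A matrix-valued function `Φ` such that `(1 - Φ(x) Φ(y)^*) k(x, y)` is a Gram matrix is a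
contractive multiplier. -/
theorem exists_matMulOp_norm_le_one {m : ℕ} {K : Type*} [NormedAddCommGroup K]
    [InnerProductSpace ℂ K] (Φ : X → Matrix (Fin m) (Fin m) ℂ) (G : X → Fin m → K)
    (h : ∀ x y a b, (1 - Φ x * (Φ y).conjTranspose) a b * ker H x y = inner ℂ (G x a) (G y b)) :
    ∃ Ψ : Matrix (Fin m) (Fin m) (Mult H), (∀ x, (Ψ.map fun φ => (φ : X → ℂ) x) = Φ x) ∧
      ‖matMulOp Ψ‖ ≤ 1 := by
  let v : X × Fin m → PiLp 2 (fun _ : Fin m => H) := fun p => PiLp.single 2 p.2 (kerVec H p.1)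
  let w : X × Fin m → PiLp 2 (fun _ : Fin m => H) :=
    fun p => WithLp.toLp 2 fun c => conj (Φ p.1 p.2 c) • kerVec H p.1
  have hvi : ∀ p f, inner ℂ (v p) f = f p.2 p.1 := fun p f => by
    rw [PiLp.inner_apply, Finset.sum_eq_single p.2]
    · simp [v, inner_kerVec]
    · intro l _ hl
      simp [v, hl]
    · simp
  have hwi : ∀ p f, inner ℂ (w p) f = ∑ c, Φ p.1 p.2 c * f c p.1 := fun p f => by
    simp [w, PiLp.inner_apply, inner_smul_left, inner_kerVec]
  have hv : (Submodule.span ℂ (Set.range v)).topologicalClosure = ⊤ := by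
    rw [Submodule.topologicalClosure_eq_top_iff, Submodule.eq_bot_iff]
    intro f hf
    ext a x
    have := (Submodule.mem_orthogonal _ _).1 hf _ (Submodule.subset_span ⟨(x, a), rfl⟩)
    rw [hvi] at this
    simpa using this
  have hG : ∀ p q, inner ℂ (v p) (v q) =
      inner ℂ (w p) (w q) + inner ℂ (G p.1 p.2) (G q.1 q.2) := by
    rintro ⟨x, a⟩ ⟨y, b⟩
    rw [hvi, hwi, ← h]
    have e1 : v (y, b) a x = (1 : Matrix (Fin m) (Fin m) ℂ) a b * ker H x y := by
      rcases eq_or_ne a b with rfl | hab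
      · simp [v, kerVec_apply]
      · simp [v, hab]
    have e2 : ∑ c, Φ x a c * w (y, b) c x = (Φ x * (Φ y).conjTranspose) a b * ker H x y := by
      rw [Matrix.mul_apply, Finset.sum_mul]
      refine Finset.sum_congr rfl fun c _ => ?_
      simp [w, RKHS.coe_smul, kerVec_apply, mul_assoc]
    rw [e1, e2, Matrix.sub_apply]
    ring
  obtain ⟨T, hT, hT1⟩ := exists_clm_of_norm_le hv (w := w) zero_le_one fun c => by
    rw [one_mul, ← sq_le_sq₀ (norm_nonneg _) (norm_nonneg _)]
    have e : ‖Finsupp.linearCombination ℂ v c‖ ^ 2 = ‖Finsupp.linearCombination ℂ w c‖ ^ 2 +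
        ‖Finsupp.linearCombination ℂ (fun p : X × Fin m => G p.1 p.2) c‖ ^ 2 := by
      refine Complex.ofReal_injective ?_
      rw [Complex.ofReal_add, norm_sq_linearCombination, norm_sq_linearCombination,
        norm_sq_linearCombination]
      simp_rw [hG, mul_add]
      simp only [Finsupp.sum, Finset.sum_add_distrib]
    rw [e]
    exact le_add_of_nonneg_right (sq_nonneg _)
  have hM : ∀ f a x, T.adjoint f a x = ∑ c, Φ x a c * f c x := fun f a x => by
    rw [← hvi (x, a), ContinuousLinearMap.adjoint_inner_right, hT, hwi]
  let Ψ : Matrix (Fin m) (Fin m) (Mult H) := Matrix.of fun a c =>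
    ⟨fun x => Φ x a c, fun f => ⟨T.adjoint (PiLp.single 2 c f) a, fun x => by
      rw [hM, Finset.sum_eq_single c]
      · simp
      · intro l _ hl
        simp [hl]
      · simp⟩⟩
  refine ⟨Ψ, fun x => rfl, ?_⟩
  have hΨ : matMulOp Ψ = T.adjoint := by
    ext f a x
    rw [matMulOp_apply, hM, ← inner_kerVec, inner_sum]
    refine Finset.sum_congr rfl fun c _ => ?_
    rw [inner_kerVec, mulOp_apply]
    rfl
  rwa [hΨ, LinearIsometryEquiv.norm_map]

/-- The lurking isometry argument: positivity of the Pick matrix gives an isometry whose transfer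
function interpolates. -/
theorem isCompleteNevanlinnaPick_of_ker_eq {j : X → 𝔻}
    (hk : ∀ x y, ker H x y = 1 / (1 - (j x : ℂ) * conj (j y : ℂ))) :
    IsCompleteNevanlinnaPick H := by
  intro m n x W hpos
  have hkm : ∀ x y, (1 - (j x : ℂ) * conj (j y : ℂ)) * ker H x y = 1 := fun x y => by
    rw [hk]
    exact mul_one_div_cancel (one_sub_mul_conj_ne_zero _ _)
  obtain ⟨B, hB⟩ := exists_eq_conjTranspose_mul_self hpos
  let K := EuclideanSpace ℂ (Fin n × Fin m)
  let E := EuclideanSpace ℂ (Fin m)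
  let γ : Fin n × Fin m → K := fun p => WithLp.toLp 2 fun r => B r p
  have hγ : ∀ p q, inner ℂ (γ p) (γ q) =
      (1 - W p.1 * (W q.1).conjTranspose) p.2 q.2 * ker H (x p.1) (x q.1) := fun p q => by
    have := congrFun (congrFun hB p) q
    rw [Matrix.of_apply] at this
    rw [this, Matrix.mul_apply, PiLp.inner_apply]
    refine Finset.sum_congr rfl fun r _ => ?_
    simp [γ, mul_comm]
  have hrow : ∀ (A B : Matrix (Fin m) (Fin m) ℂ) (a b : Fin m),
      inner ℂ (WithLp.toLp 2 fun c => conj (A a c) : E) (WithLp.toLp 2 fun c => conj (B b c)) =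
        (A * B.conjTranspose) a b := fun A B a b => by
    rw [Matrix.mul_apply, PiLp.inner_apply]
    refine Finset.sum_congr rfl fun r _ => ?_
    simp [mul_comm]
  have hone : ∀ a b : Fin m, inner ℂ (EuclideanSpace.single a (1 : ℂ) : E)
      (EuclideanSpace.single b (1 : ℂ)) = (1 : Matrix (Fin m) (Fin m) ℂ) a b := fun a b => by
    rw [EuclideanSpace.inner_single_left, Matrix.one_apply]
    simp
  -- `δ_ab + z_p conj z_q ⟨γ_p, γ_q⟩ = (W_p W_q^*)_ab + ⟨γ_p, γ_q⟩` is an equality of Gram matrices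
  obtain ⟨L, hL⟩ := exists_linearIsometry_of_inner_eq (V := WithLp 2 (E × K))
    (u := fun p : Fin n × Fin m => WithLp.toLp 2
      ((EuclideanSpace.single p.2 (1 : ℂ) : E), conj (j (x p.1) : ℂ) • γ p))
    (v := fun p => WithLp.toLp 2
      ((WithLp.toLp 2 fun c => conj (W p.1 p.2 c) : E), γ p)) (by
    intro p q
    rw [WithLp.prod_inner_apply, WithLp.prod_inner_apply]
    simp only [hrow, hone, inner_smul_left, inner_smul_right, hγ, Complex.conj_conj,
      Matrix.sub_apply]
    linear_combination (-((1 : Matrix (Fin m) (Fin m) ℂ) p.2 q.2) +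
      (W p.1 * (W q.1).conjTranspose) p.2 q.2) * hkm (x p.1) (x q.1))
  choose G hG hGu using fun (y : X) (a : Fin m) =>
    existsUnique_snd_eq L (j y) (EuclideanSpace.single a (1 : ℂ))
  let Φ : X → Matrix (Fin m) (Fin m) ℂ := fun y => Matrix.of fun a c => conj
    ((L (WithLp.toLp 2 (EuclideanSpace.single a (1 : ℂ), conj (j y : ℂ) • G y a))).fst c)
  have hLΦ : ∀ y a, L (WithLp.toLp 2 (EuclideanSpace.single a (1 : ℂ), conj (j y : ℂ) • G y a)) =
      WithLp.toLp 2 ((WithLp.toLp 2 fun c => conj (Φ y a c) : E), G y a) := fun y a => by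
    refine WithLp.ofLp_injective 2 (Prod.ext ?_ (hG y a))
    ext c
    simp [Φ]
  obtain ⟨Ψ, hΨ, hΨ1⟩ := exists_matMulOp_norm_le_one (H := H) Φ G (fun y y' a b => by
    have h1 := L.inner_map_map
      (WithLp.toLp 2 (EuclideanSpace.single a (1 : ℂ), conj (j y : ℂ) • G y a))
      (WithLp.toLp 2 (EuclideanSpace.single b (1 : ℂ), conj (j y' : ℂ) • G y' b))
    rw [hLΦ, hLΦ, WithLp.prod_inner_apply, WithLp.prod_inner_apply] at h1
    simp only [hrow, hone, inner_smul_left, inner_smul_right, Complex.conj_conj] at h1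
    rw [Matrix.sub_apply]
    linear_combination (-ker H y y') * h1 + inner ℂ (G y a) (G y' b) * hkm y y')
  refine ⟨Ψ, fun i => ?_, hΨ1⟩
  rw [hΨ]
  ext a c
  -- by uniqueness, the transfer function takes the prescribed values at the nodes
  have h1 : γ (i, a) = G (x i) a := hGu (x i) a _ (by
    have := congrArg WithLp.snd (hL (i, a))
    exact this)
  have h2 := hL (i, a)
  simp only [h1] at h2
  have h3 := congrArg (fun v => conj (v.fst c)) h2
  simpa [Φ] using h3

end Pick

section Characterization

variable {H : Type*} {X : Type*} [NormedAddCommGroup H] [InnerProductSpace ℂ H]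
  [CompleteSpace H] [RKHS ℂ H X ℂ]

/-! ### Characterization of spaces of weak Hardy type -/

theorem ker_ne_zero_of_ker_eq {j : X → 𝔻}
    (hk : ∀ x y, ker H x y = 1 / (1 - (j x : ℂ) * conj (j y : ℂ))) (x y : X) :
    ker H x y ≠ 0 := by
  rw [hk]
  exact one_div_ne_zero (one_sub_mul_conj_ne_zero _ _)

theorem isIrreducible_of_ker_eq {x₀ : X} (hx₀ : IsNormalizedAt H x₀) {j : X → 𝔻}
    (hj : Function.Injective j)
    (hk : ∀ x y, ker H x y = 1 / (1 - (j x : ℂ) * conj (j y : ℂ))) : IsIrreducible H := by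
  refine ⟨ker_ne_zero_of_ker_eq hk, fun x y hxy => ?_⟩
  rw [LinearIndependent.pair_iff]
  intro s t hst
  have hev : ∀ z, s * ker H z x + t * ker H z y = 0 := fun z => by
    have := congrArg (fun f : H => f z) hst
    simpa [RKHS.coe_add, RKHS.coe_smul, kerVec_apply] using this
  have h0 : ∀ z, ker H x₀ z = 1 := fun z => by rw [← conj_ker, hx₀, map_one]
  have ht : t = -s := by
    have := hev x₀
    rw [h0, h0] at this
    linear_combination this
  subst ht
  suffices hs : s = 0 by simp [hs]
  by_contra hs
  have hker : ∀ z, ker H z x = ker H z y := fun z =>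
    mul_left_cancel₀ hs (by linear_combination hev z)
  have hconj : ∀ z, (j z : ℂ) * conj (j x : ℂ) = j z * conj (j y : ℂ) := fun z => by
    have := hker z
    rw [hk, hk] at this
    simpa using this
  have h2 : ((j x : ℂ) - j y) * conj ((j x : ℂ) - j y) = 0 := by
    rw [map_sub]
    linear_combination hconj x - hconj y
  rw [Complex.mul_conj, Complex.ofReal_eq_zero, Complex.normSq_eq_zero, sub_eq_zero] at h2
  exact hxy (hj (Complex.UnitDisc.coe_injective h2))

/-- If the multiplier norm is the supremum norm, then no nonzero element of the Hardy space
vanishes on the range of `j`. -/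
theorem eq_zero_of_apply_eq_zero [Nontrivial X] {x₀ : X} (hx₀ : IsNormalizedAt H x₀)
    (hsup : ∀ φ : Mult H, ‖mulOp φ‖ₑ = ⨆ x : X, ‖(φ : X → ℂ) x‖ₑ) {j : X → 𝔻}
    (hj : Function.Injective j) (hj0 : j x₀ = 0)
    (hk : ∀ x y, ker H x y = 1 / (1 - (j x : ℂ) * conj (j y : ℂ))) {f : HardySpace}
    (hf : ∀ x, f (j x) = 0) : f = 0 := by
  by_contra h0
  obtain ⟨g, hg0, hg⟩ := HardySpace.exists_apply_zero_ne_zero (A := Set.range j) h0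
    (by rintro _ ⟨x, rfl⟩; exact hf x)
  obtain ⟨U, -, -, -, hU, -⟩ := exists_comp_clm hk
  refine not_exists_eq_indicator hx₀ hsup (e := (g 0)⁻¹ • U g) ?_ fun x hx => ?_
  · rw [RKHS.coe_smul, Pi.smul_apply, hU, hj0, smul_eq_mul, inv_mul_cancel₀ hg0]
  · rw [RKHS.coe_smul, Pi.smul_apply, hU, hg _ ⟨x, rfl⟩ (by rw [← hj0]; exact hj.ne hx), smul_zero]

theorem IsWeakHardyType.exists_isDominating [Nontrivial X] {x₀ : X} (hx₀ : IsNormalizedAt H x₀)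
    (hH : IsWeakHardyType H) :
    ∃ (A : Set 𝔻) (j : X → 𝔻), IsDominating A ∧ Set.BijOn j Set.univ A ∧
      IsMultiplier H (fun x => (j x : ℂ)) ∧ j x₀ = 0 ∧
      ∀ x y : X, ker H x y = 1 / (1 - (j x : ℂ) * conj (j y : ℂ)) := by
  obtain ⟨f, hf0, hf1, hfk⟩ := exists_ker_eq_szego hx₀ hH
  obtain ⟨-, hirr, -, hsup⟩ := hH
  let j : X → 𝔻 := fun x => .mk ((f : X → ℂ) x) (hf1 x)
  have hk : ∀ x y, ker H x y = 1 / (1 - (j x : ℂ) * conj (j y : ℂ)) := hfk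
  have hj : Function.Injective j := fun x y hxy => by
    by_contra hne
    refine (hirr.2 x y hne).injective.ne (a₁ := 0) (a₂ := 1) (by simp) ?_
    refine RKHS.ext (𝕜 := ℂ) fun z => ?_
    change ker H z x = ker H z y
    rw [hk, hk, hxy]
  have hj0 : j x₀ = 0 := Complex.UnitDisc.coe_injective hf0
  obtain ⟨U, hU⟩ := exists_comp_linearIsometryEquiv hk
    fun f hf => eq_zero_of_apply_eq_zero hx₀ hsup hj hj0 hk hf
  refine ⟨Set.range j, j, isDominating_range hU hsup, ?_, f.2, hj0, hk⟩
  rw [← Set.image_univ]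
  exact hj.injOn.bijOn_image

theorem exists_comp_linearIsometryEquiv_of_isDominating {A : Set 𝔻} {j : X → 𝔻}
    (hA : IsDominating A) (hj : Set.BijOn j Set.univ A)
    (hk : ∀ x y, ker H x y = 1 / (1 - (j x : ℂ) * conj (j y : ℂ))) :
    ∃ U : HardySpace ≃ₗᵢ[ℂ] H, ∀ (f : HardySpace) (x : X), U f x = f (j x) := by
  refine exists_comp_linearIsometryEquiv hk fun f hf => hA.eq_zero fun z hz => ?_
  obtain ⟨x, -, rfl⟩ := hj.surjOn hz
  exact hf x

theorem isWeakHardyType_of_isDominating {x₀ : X} (hx₀ : IsNormalizedAt H x₀) {A : Set 𝔻}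
    {j : X → 𝔻} (hA : IsDominating A) (hj : Set.BijOn j Set.univ A)
    (hk : ∀ x y, ker H x y = 1 / (1 - (j x : ℂ) * conj (j y : ℂ))) : IsWeakHardyType H := by
  obtain ⟨U, hU⟩ := exists_comp_linearIsometryEquiv_of_isDominating hA hj hk
  have hA' : IsDominating (Set.range j) := by rwa [← Set.image_univ, hj.image_eq]
  exact ⟨⟨x₀, hx₀⟩, isIrreducible_of_ker_eq hx₀ (Set.injOn_univ.1 hj.injOn) hk,
    isCompleteNevanlinnaPick_of_ker_eq hk,
    enorm_mulOp_eq_iSup hU hA' hx₀ fun x => ker_ne_zero_of_ker_eq hk x x⟩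

end Characterization

end WeakHardy

end

theorem mainTheorem1 {X H : Type*} [Nontrivial X] [NormedAddCommGroup H] [InnerProductSpace ℂ H]
    [CompleteSpace H] [RKHS ℂ H X ℂ] (x₀ : X) (hx₀ : WeakHardy.IsNormalizedAt H x₀) :
    (WeakHardy.IsWeakHardyType H ↔
      ∃ (A : Set 𝔻) (j : X → 𝔻), WeakHardy.IsDominating A ∧ Set.BijOn j Set.univ A ∧
        WeakHardy.IsMultiplier H (fun x => (j x : ℂ)) ∧ j x₀ = 0 ∧
        ∀ x y : X, WeakHardy.ker H x y = 1 / (1 - (j x : ℂ) * conj (j y : ℂ))) ∧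
    ∀ (A : Set 𝔻) (j : X → 𝔻), WeakHardy.IsDominating A → Set.BijOn j Set.univ A →
      WeakHardy.IsMultiplier H (fun x => (j x : ℂ)) → j x₀ = 0 →
      (∀ x y : X, WeakHardy.ker H x y = 1 / (1 - (j x : ℂ) * conj (j y : ℂ))) →
      ∃ U : WeakHardy.HardySpace ≃ₗᵢ[ℂ] H,
        ∀ (f : WeakHardy.HardySpace) (x : X), U f x = f (j x) := by
  refine ⟨⟨fun hH => hH.exists_isDominating hx₀, ?_⟩, ?_⟩
  · rintro ⟨A, j, hA, hj, -, -, hk⟩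
    exact WeakHardy.isWeakHardyType_of_isDominating hx₀ hA hj hk
  · intro A j hA hj _ _ hk
    exact WeakHardy.exists_comp_linearIsometryEquiv_of_isDominating hA hj hk
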